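/- **Setting.** Base types are $B ::= \tau \mid C\,B_1\cdots B_m$; types are $T ::= B \mid B\to T$; ground types contain no type variables. $B'\sqsubseteq B$ means $B'=\sigma B$ for some substitution $\sigma$. With an added least element $\bot$, and up to renaming of type variables, base types form the subsumption lattice, whose meet is computed by most general unifiers (mgu). A library $\Lambda$ is a finite map from components $c$ to polytypes. Terms are $e ::= x\mid c\mid e\,e$ and $E ::= e\mid \lambda x.E$, and $\vdash E:t$ ($t$ ground) is the usual declarative typing, in which the type variables of a component are instantiated with ground base types. The size of a term is its number of component occurrences; a candidate for $t=b_1\to\dots\to b_n\to b$ is an $\eta$-long term $\lambda x_1\dots x_n.e$. For $c:\overline{B'_i}\to B'$ (fresh instance), the type transformer is $[\![c]\!](\overline{B_i})=\sigma B'$ with $\sigma=\mathrm{mgu}(\overline{B_i,B'_i})$, and $\bot$ if there is no unifier. An abstract cover $\mathcal A$ is a finite set of base types that contains $\tau$ and $\bot$ and is closed under meet; $\alpha_{\mathcal A}(B)$ is the most specific element of $\mathcal A$ that subsumes $B$. Abstract inference assigns $\alpha_{\mathcal A}(b_i)$ to $x_i$ and $\alpha_{\mathcal A}([\![c]\!](\overline{B_j}))$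 to $c\,\overline{e_j}$, where $B_j$ is the type inferred for $e_j$; $\vdash_{\mathcal A}\lambda\overline{x_i}.e\Leftarrow t$ ("abstractly well-typed") means that $b\sqsubseteq B$ for the type $B$ inferred for $e$. Concrete checking $\vdash E\Leftarrow t$ is the same with $\alpha$ the identity. The abstract transition net $\mathcal N(\Lambda,t,\mathcal A)$ is the Petri net with places $\mathcal A\setminus\{\bot\}$, initial marking given by the places $\alpha_{\mathcal A}(b_i)$ with multiplicity, final places those that subsume $b$, a component transition $A_1,\dots,A_m\to A$ for every $c$ and all places with $\alpha_{\mathcal A}([\![c]\!](A_1,\dots,A_m))=A$, and a copy and a delete transition at every initially marked place. A valid path leads from the initial marking to a marking with exactly one token, which is in a final place. Its programs are obtained by symbolic execution, in which tokens carry terms, the $i$-th initial token carries $x_i$, and a component transition may consume any tokens in its input places and pass their terms in any order. The length of a path is either (a) the number of all its transitions or (b) the number of its component transitions. $\mathrm{SynAbstract}(\Lambda,t,\mathcal A)$ takes a shortest valid path, in the fixed sense (a) or (b), and returns an abstractly well-typed program of that path, or $\bot$ if there is no valid path. $\mathrm{Refine}(\mathcal A,\lambda\overline{x_i}.e,t)$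 labels the nodes of the syntax tree of $r\,e$, where $r:b\to b$ is a new component, with their concrete inferred types. It then weakens the labels top-down: for an application of $c$ with label $R$, labels $B_j\ne\bot$ of its arguments are repeatedly replaced by strictly more general ones as long as $[\![c]\!](\overline{B_j})\sqsubseteq R$. It returns the closure under meet of $\mathcal A$ together with all labels. $\mathrm{Synthesize}(\Lambda,t,\mathcal A_0)$ starts with $\mathcal A=\mathcal A_0$ and repeats: let $E=\mathrm{SynAbstract}(\Lambda,t,\mathcal A)$; return $\bot$ if $E=\bot$; return $E$ if $\vdash E\Leftarrow t$; otherwise ($E$ is spurious) set $\mathcal A:=\mathrm{Refine}(\mathcal A,E,t)$. All choices left open (the shortest path, the order of the programs of a path, the weakening strategy and when it stops) are arbitrary, and the claims hold for all of them. **Theorem (Completeness of Synthesize).** Let $\Lambda$ be a library and $t$ a ground query type. For each of the path lengths (a), (b): 1. Suppose $\vdash E:t$ for some $E$. Then there is $N$, which depends only on $\Lambda,t,E$ and the choice of (a) or (b), and which is the size of $E$ in case (b), such that there are only finitely many candidates of size at most $N$, say $k$, and for every abstract cover $\mathcal A_0$: every execution of $\mathrm{Synthesize}(\Lambda,t,\mathcal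 A_0)$ terminates after at most $k$ iterations and returns some $E'\neq\bot$, with $\vdash E':t$. The candidates that $\mathrm{SynAbstract}$ returns in the course of an execution are pairwise distinct, and they have size at most $N$. 2. For every abstract cover $\mathcal A$: every path has finitely many programs; $\mathrm{SynAbstract}(\Lambda,t,\mathcal A)$ always has a result; it can be $\bot$ if and only if no candidate is abstractly well-typed. Any candidate that it returns is abstractly well-typed and is shortest among all abstractly well-typed candidates, where the length of a candidate is the least length of a valid path that yields it (every abstractly well-typed candidate is yielded by some valid path). In case (b), it also has the least size among all abstractly well-typed candidates. 3. For every abstract cover $\mathcal A$ and every candidate $E$ with $\vdash_{\mathcal A}E\Leftarrow t$ but not $\vdash E\Leftarrow t$: every weakening loop terminates, $\mathrm{Refine}(\mathcal A,E,t)$ has a result, and every result $\mathcal A'$ is an abstract cover with $\mathcal A\subseteq\mathcal A'$ and not $\vdash_{\mathcal A'}E\Leftarrow t$. -/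

import Mathlib

namespace TYGAR

/-! ## Types -/

/-- A set of type constructors with their arities. -/
structure TyCons where
  Con : Type
  arity : Con → ℕ

/-- Base types `B ::= τ | C B₁ … Bₘ`, with type variables drawn from `V`. -/
inductive Base (K : TyCons) (V : Type) : Type
  | var (v : V) : Base K V
  | con (C : K.Con) (args : Fin (K.arity C) → Base K V) : Base K V

/-- Ground base types `b`: no type variables. -/
abbrev Ground (K : TyCons) : Type := Base K Empty

/-- Application of a substitution to a base type. -/
def Base.subst {K : TyCons} {V W : Type} (σ : V → Base K W) : Base K V → Base K W
  | .var v => σ v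
  | .con C args => .con C fun i => (args i).subst σ

/-- Renaming of type variables. -/
def Base.rename {K : TyCons} {V W : Type} (f : V → W) (B : Base K V) : Base K W :=
  B.subst fun v => .var (f v)

theorem Base.subst_var {K : TyCons} {V : Type} (B : Base K V) : B.subst Base.var = B := by
  induction B with
  | var v => rfl
  | con C args ih => simp only [Base.subst, ih]

theorem Base.subst_subst {K : TyCons} {V W X : Type} (σ : V → Base K W) (ρ : W → Base K X)
    (B : Base K V) : (B.subst σ).subst ρ = B.subst fun v => (σ v).subst ρ := by
  induction B with
  | var v => rfl
  | con C args ih => simp only [Base.subst, ih]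

/-- Subsumption: `B' ≤ B` (`B'` is more specific than `B`) iff `B' = σ B` for some `σ`. -/
instance Base.instPreorder (K : TyCons) : Preorder (Base K ℕ) where
  le B' B := ∃ σ : ℕ → Base K ℕ, B' = B.subst σ
  le_refl B := ⟨Base.var, B.subst_var.symm⟩
  le_trans A B C := by
    rintro ⟨σ, rfl⟩ ⟨ρ, rfl⟩
    exact ⟨fun v => (ρ v).subst σ, Base.subst_subst ρ σ C⟩

/-- The subsumption lattice: base types together with a least element `⊥`, up to equivalence
(renaming of type variables). Since elements are equivalence classes, the scope of a type variable
is the individual base type. -/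
abbrev AbsTy (K : TyCons) : Type :=
  Antisymmetrization (WithBot (Base K ℕ)) (· ≤ ·)

/-- The class of a base type or of `⊥`. -/
def AbsTy.mk {K : TyCons} (B : WithBot (Base K ℕ)) : AbsTy K := toAntisymmetrization (· ≤ ·) B

/-- Some representative of a class. -/
noncomputable def AbsTy.rep {K : TyCons} (A : AbsTy K) : WithBot (Base K ℕ) :=
  ofAntisymmetrization (· ≤ ·) A

/-- The class of a type variable. -/
def AbsTy.top (K : TyCons) : AbsTy K := .mk ((Base.var 0 : Base K ℕ) : WithBot (Base K ℕ))

/-- The class of `⊥`. -/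
def AbsTy.bot (K : TyCons) : AbsTy K := .mk ⊥

/-- A ground base type regarded as a base type. -/
def Base.ofGround {K : TyCons} (b : Ground K) : Base K ℕ := b.subst fun v => v.elim

/-- The class of a ground base type. -/
def AbsTy.ground {K : TyCons} (b : Ground K) : AbsTy K :=
  .mk (Base.ofGround b : WithBot (Base K ℕ))

/-! ## Unification -/

/-- `σ` unifies a family of pairs of base types. -/
def Unifies {K : TyCons} {V ι : Type} (σ : V → Base K ℕ) (eqs : ι → Base K V × Base K V) : Prop :=
  ∀ i, (eqs i).1.subst σ = (eqs i).2.subst σ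

/-- `σ` is a most general unifier of a family of pairs of base types. -/
def IsMGU {K : TyCons} {V ι : Type} (σ : V → Base K ℕ) (eqs : ι → Base K V × Base K V) : Prop :=
  Unifies σ eqs ∧
    ∀ θ : V → Base K ℕ, Unifies θ eqs → ∃ ρ : ℕ → Base K ℕ, ∀ v, θ v = (σ v).subst ρ

open Classical in
/-- `σ B` for `σ` a most general unifier of `eqs`; it is `⊥` if there is no (proper) unifier. -/
noncomputable def applyMGU {K : TyCons} {V ι : Type} (eqs : ι → Base K V × Base K V)
    (B : Base K V) : WithBot (Base K ℕ) :=
  if h : ∃ σ, IsMGU σ eqs then ((B.subst h.choose : Base K ℕ) : WithBot (Base K ℕ)) else ⊥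

/-- The meet on representatives: `σ B₁` for `σ` the most general unifier of `B₁` and `B₂`, whose
variables are first renamed apart. -/
noncomputable def meetRep {K : TyCons} : WithBot (Base K ℕ) → WithBot (Base K ℕ) →
    WithBot (Base K ℕ)
  | some B₁, some B₂ =>
      applyMGU (V := ℕ ⊕ ℕ) (fun _ : Unit => (B₁.rename Sum.inl, B₂.rename Sum.inr))
        (B₁.rename Sum.inl)
  | _, _ => ⊥

/-- The meet of the subsumption lattice. -/
noncomputable def AbsTy.meet {K : TyCons} (A B : AbsTy K) : AbsTy K := .mk (meetRep A.rep B.rep)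

/-! ## Function types, libraries, and the declarative type system -/

/-- Types `T ::= B | B → T`. -/
inductive Ty (K : TyCons) (V : Type) : Type
  | base (B : Base K V) : Ty K V
  | arrow (B : Base K V) (T : Ty K V) : Ty K V

def Ty.subst {K : TyCons} {V W : Type} (σ : V → Base K W) : Ty K V → Ty K W
  | .base B => .base (B.subst σ)
  | .arrow B T => .arrow (B.subst σ) (T.subst σ)

/-- `B₁, …, Bₙ` for `B₁ → … → Bₙ → B`. -/
def Ty.args {K : TyCons} {V : Type} : Ty K V → List (Base K V)
  | .base _ => []
  | .arrow B T => B :: T.args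

/-- `B` for `B₁ → … → Bₙ → B`. -/
def Ty.res {K : TyCons} {V : Type} : Ty K V → Base K V
  | .base B => B
  | .arrow _ T => T.res

/-- A component library: a finite set of components, each with a polytype; all type variables
`0, 1, 2, …` of `ty c` are universally quantified. -/
structure Library (K : TyCons) where
  Comp : Type
  finite : Finite Comp
  ty : Comp → Ty K ℕ

def Library.arity {K : TyCons} (Λ : Library K) (c : Λ.Comp) : ℕ := (Λ.ty c).args.length

/-- Application terms `e ::= x | c | e e`. The variable `x_i` is the one bound by the `i`-th
`λ`, counted from the outside, starting with `0`. -/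
inductive Tm {K : TyCons} (Λ : Library K) : Type
  | var (i : ℕ) : Tm Λ
  | comp (c : Λ.Comp) : Tm Λ
  | app (e₁ e₂ : Tm Λ) : Tm Λ

/-- Normal-form terms `E ::= e | λx. E`. -/
inductive NTm {K : TyCons} (Λ : Library K) : Type
  | body (e : Tm Λ) : NTm Λ
  | lam (E : NTm Λ) : NTm Λ

/-- Declarative typing of application terms. -/
inductive Typing {K : TyCons} (Λ : Library K) (Γ : List (Ground K)) : Tm Λ → Ty K Empty → Prop
  | var (i : ℕ) (b : Ground K) : Γ[i]? = some b → Typing Λ Γ (.var i) (.base b)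
  | comp (c : Λ.Comp) (σ : ℕ → Ground K) : Typing Λ Γ (.comp c) ((Λ.ty c).subst σ)
  | app (e₁ e₂ : Tm Λ) (b : Ground K) (t : Ty K Empty) :
      Typing Λ Γ e₁ (.arrow b t) → Typing Λ Γ e₂ (.base b) → Typing Λ Γ (.app e₁ e₂) t

/-- Declarative typing `Γ ⊢ E : t` of normal-form terms. -/
inductive NTyping {K : TyCons} (Λ : Library K) : List (Ground K) → NTm Λ → Ty K Empty → Prop
  | body (Γ : List (Ground K)) (e : Tm Λ) (t : Ty K Empty) :
      Typing Λ Γ e t → NTyping Λ Γ (.body e) t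
  | lam (Γ : List (Ground K)) (E : NTm Λ) (b : Ground K) (t : Ty K Empty) :
      NTyping Λ (Γ ++ [b]) E t → NTyping Λ Γ (.lam E) (.arrow b t)

/-- The number of component occurrences. -/
def Tm.size {K : TyCons} {Λ : Library K} : Tm Λ → ℕ
  | .var _ => 0
  | .comp _ => 1
  | .app e₁ e₂ => e₁.size + e₂.size

def NTm.size {K : TyCons} {Λ : Library K} : NTm Λ → ℕ
  | .body e => e.size
  | .lam E => E.size

/-! ## Terms in `η`-long form and (abstract) type checking -/

/-- Uncurried application terms in `η`-long form, `e ::= x_i | c e₁ … eₘ` with `m` the arity of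
`c`, over the variables `x_0, …, x_{n-1}`. -/
inductive ATm {K : TyCons} (Λ : Library K) (n : ℕ) : Type
  | var (i : Fin n) : ATm Λ n
  | app (c : Λ.Comp) (es : Fin (Λ.arity c) → ATm Λ n) : ATm Λ n

/-- Candidate programs for the query `t = b₁ → … → bₙ → b`: an element `e` stands for the
normal-form term `λ x_0 … x_{n-1}. e` in `η`-long form. -/
abbrev Prog {K : TyCons} (Λ : Library K) (t : Ty K Empty) : Type := ATm Λ t.args.length

/-- The number of component applications. -/
def ATm.size {K : TyCons} {Λ : Library K} {n : ℕ} : ATm Λ n → ℕ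
  | .var _ => 0
  | .app _ es => 1 + ∑ i, (es i).size

/-- The curried form `(… (c e₁) …) eₘ`. -/
def ATm.curry {K : TyCons} {Λ : Library K} {n : ℕ} : ATm Λ n → Tm Λ
  | .var i => .var i
  | .app c es => (List.ofFn fun i => (es i).curry).foldl Tm.app (.comp c)

/-- The normal-form term `λ x_0 … x_{n-1}. e`. -/
def ATm.close {K : TyCons} {Λ : Library K} {n : ℕ} (e : ATm Λ n) : NTm Λ :=
  NTm.lam^[n] (.body e.curry)

open Classical in
/-- The type transformer of `c` on representatives: for the fresh instance `B'₁ → … → B'ₘ → B'` of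
the type of `c`, it is `σ B'` with `σ` the most general unifier of the pairs `(Bᵢ, B'ᵢ)`, where the
variables of `B₁, …, Bₘ` and those of the fresh instance are renamed apart. -/
noncomputable def Library.semRep {K : TyCons} (Λ : Library K) (c : Λ.Comp)
    (Bs : Fin (Λ.arity c) → WithBot (Base K ℕ)) : WithBot (Base K ℕ) :=
  if h : ∀ i, Bs i ≠ ⊥ then
    applyMGU (V := ℕ ⊕ (Fin (Λ.arity c) × ℕ))
      (fun i : Fin (Λ.arity c) =>
        (((Bs i).unbot (h i)).rename fun v => Sum.inr (i, v),
          ((Λ.ty c).args.get i).rename Sum.inl))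
      ((Λ.ty c).res.rename Sum.inl)
  else ⊥

/-- The type transformer `⟦c⟧`. -/
noncomputable def Library.sem {K : TyCons} (Λ : Library K) (c : Λ.Comp)
    (As : Fin (Λ.arity c) → AbsTy K) : AbsTy K :=
  .mk (Λ.semRep c fun i => (As i).rep)

/-- Type inference `Γ ⊢ e ⇒ B` for application terms, with the function `α` applied to every
inferred type: abstract inference if `α` is the abstraction function of a cover, concrete
inference if `α = id`. -/
noncomputable def ATm.infer {K : TyCons} {Λ : Library K} {n : ℕ} (α : AbsTy K → AbsTy K)
    (Γ : Fin n → Ground K) : ATm Λ n → AbsTy K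
  | .var i => α (.ground (Γ i))
  | .app c es => α (Λ.sem c fun i => (es i).infer α Γ)

/-- Type checking `⊢ λ x_0 … x_{n-1}. e ⇐ b₁ → … → bₙ → b`: with `xᵢ` of the `i`-th argument type,
a type that subsumes `b` is inferred for `e`. -/
def Check {K : TyCons} {Λ : Library K} (α : AbsTy K → AbsTy K) (t : Ty K Empty)
    (e : Prog Λ t) : Prop :=
  AbsTy.ground t.res ≤ e.infer α t.args.get

/-- Concrete type checking `⊢ E ⇐ t`. -/
def ConcreteCheck {K : TyCons} {Λ : Library K} (t : Ty K Empty) (e : Prog Λ t) : Prop :=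
  Check id t e

/-- An abstract cover: a finite set of base types that contains `τ` and `⊥` and is closed under
meet. -/
structure IsCover {K : TyCons} (𝒜 : Set (AbsTy K)) : Prop where
  finite : 𝒜.Finite
  top_mem : AbsTy.top K ∈ 𝒜
  bot_mem : AbsTy.bot K ∈ 𝒜
  meet_mem : ∀ A ∈ 𝒜, ∀ B ∈ 𝒜, A.meet B ∈ 𝒜

open Classical in
/-- The abstraction function: the most specific type of `𝒜` that subsumes `B` (which exists if
`𝒜` is a cover). -/
noncomputable def abstr {K : TyCons} (𝒜 : Set (AbsTy K)) (B : AbsTy K) : AbsTy K :=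
  if h : ∃ A, IsLeast {A | A ∈ 𝒜 ∧ B ≤ A} A then h.choose else B

/-- Abstract type checking `⊢_𝒜 E ⇐ t`. -/
def AbsCheck {K : TyCons} {Λ : Library K} (𝒜 : Set (AbsTy K)) (t : Ty K Empty)
    (e : Prog Λ t) : Prop :=
  Check (abstr 𝒜) t e

/-! ## Abstract transition nets -/

/-- A Petri net with places from `P` and transitions from `T`; `pre p t` and `post t p` are the
edge multiplicities `E(p, t)` and `E(t, p)`. -/
structure PetriNet (P T : Type) where
  places : Set P
  transitions : Set T
  pre : P → T → ℕ
  post : T → P → ℕ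

/-- The transition firing `M₁ → M₂` by `t`. -/
def PetriNet.Fires {P T : Type} (N : PetriNet P T) (M₁ : P → ℕ) (t : T) (M₂ : P → ℕ) : Prop :=
  t ∈ N.transitions ∧ ∀ p, N.pre p t ≤ M₁ p ∧ M₂ p = M₁ p - N.pre p t + N.post t p

/-- `N.IsPath M π M'`: the sequence of transitions `π` is a path from `M` to `M'`. -/
inductive PetriNet.IsPath {P T : Type} (N : PetriNet P T) : (P → ℕ) → List T → (P → ℕ) → Prop
  | nil (M : P → ℕ) : N.IsPath M [] M
  | cons (M₁ M₂ M₃ : P → ℕ) (t : T) (π : List T) :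
      N.Fires M₁ t M₂ → N.IsPath M₂ π M₃ → N.IsPath M₁ (t :: π) M₃

/-- Transitions: an abstract instance `A₁, …, Aₘ → A` of a component, and the copy and delete
transitions at a place. -/
inductive Transition {K : TyCons} (Λ : Library K) : Type
  | comp (c : Λ.Comp) (As : Fin (Λ.arity c) → AbsTy K) (A : AbsTy K) : Transition Λ
  | copy (p : AbsTy K) : Transition Λ
  | delete (p : AbsTy K) : Transition Λ

/-- A Petri net together with its initial marking and its set of final places. -/
structure TransitionNet (P T : Type) extends PetriNet P T where
  init : P → ℕ
  final : Set P

open Classical in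
/-- The abstract transition net of the abstract synthesis problem `(Λ, t, 𝒜)`. -/
noncomputable def atn {K : TyCons} (Λ : Library K) (t : Ty K Empty) (𝒜 : Set (AbsTy K)) :
    TransitionNet (AbsTy K) (Transition Λ) :=
  let P : Set (AbsTy K) := 𝒜 \ {AbsTy.bot K}
  let I : AbsTy K → ℕ := fun p =>
    (Finset.univ.filter fun i : Fin t.args.length =>
      abstr 𝒜 (AbsTy.ground (t.args.get i)) = p).card
  { places := P
    transitions := fun
      | .comp c As A => (∀ j, As j ∈ P) ∧ A ∈ P ∧ abstr 𝒜 (Λ.sem c As) = A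
      | .copy p => p ∈ P ∧ 0 < I p
      | .delete p => p ∈ P ∧ 0 < I p
    pre := fun p => fun
      | .comp _ As _ => (Finset.univ.filter fun j => As j = p).card
      | .copy q => if p = q then 1 else 0
      | .delete q => if p = q then 1 else 0
    post := fun
      | .comp _ _ A => fun p => if p = A then 1 else 0
      | .copy q => fun p => if p = q then 2 else 0
      | .delete _ => fun _ => 0
    init := I
    final := {A | A ∈ P ∧ AbsTy.ground t.res ≤ A} }

/-- A valid path leads from the initial marking to a marking that has exactly one token in some
final place and no other token. -/
def TransitionNet.ValidPath {P T : Type} (N : TransitionNet P T) (π : List T) : Prop :=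
  ∃ M : P → ℕ, N.IsPath N.init π M ∧ ∃ f ∈ N.final, M f = 1 ∧ ∀ p ∈ N.places, p ≠ f → M p = 0

/-! ## From paths to programs -/

/-- Tokens that carry terms: pairs of a place and the term that the token stands for. -/
abbrev Tokens {K : TyCons} (Λ : Library K) (n : ℕ) : Type := Multiset (AbsTy K × ATm Λ n)

/-- Symbolic execution of one transition. A component transition consumes tokens from its input
places and applies the component to their terms. A path neither distinguishes the tokens in one
place nor orders the incoming edges of a transition, so the tokens may be any tokens in these
places, and the terms may be passed in any order `s`. -/
inductive TokStep {K : TyCons} {Λ : Library K} {n : ℕ} :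
    Transition Λ → Tokens Λ n → Tokens Λ n → Prop
  | comp (c : Λ.Comp) (As : Fin (Λ.arity c) → AbsTy K) (A : AbsTy K)
      (s : Equiv.Perm (Fin (Λ.arity c))) (es : Fin (Λ.arity c) → ATm Λ n) (R : Tokens Λ n) :
      TokStep (.comp c As A) (Finset.univ.val.map (fun j => (As (s j), es j)) + R)
        ((A, .app c es) ::ₘ R)
  | copy (p : AbsTy K) (e : ATm Λ n) (R : Tokens Λ n) :
      TokStep (.copy p) ((p, e) ::ₘ R) ((p, e) ::ₘ (p, e) ::ₘ R)
  | delete (p : AbsTy K) (e : ATm Λ n) (R : Tokens Λ n) :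
      TokStep (.delete p) ((p, e) ::ₘ R) R

inductive TokRun {K : TyCons} {Λ : Library K} {n : ℕ} :
    Tokens Λ n → List (Transition Λ) → Tokens Λ n → Prop
  | nil (S : Tokens Λ n) : TokRun S [] S
  | cons (S₁ S₂ S₃ : Tokens Λ n) (x : Transition Λ) (π : List (Transition Λ)) :
      TokStep x S₁ S₂ → TokRun S₂ π S₃ → TokRun S₁ (x :: π) S₃

/-- Initially the `i`-th argument `x_i` is a token in the place of the abstraction of its type. -/
noncomputable def initTokens {K : TyCons} (Λ : Library K) (t : Ty K Empty)
    (𝒜 : Set (AbsTy K)) : Tokens Λ t.args.length :=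
  Finset.univ.val.map fun i => (abstr 𝒜 (AbsTy.ground (t.args.get i)), .var i)

/-- The set of programs of a path. -/
def fromPath {K : TyCons} (Λ : Library K) (t : Ty K Empty) (𝒜 : Set (AbsTy K))
    (π : List (Transition Λ)) : Set (Prog Λ t) :=
  {e | ∃ f, TokRun (initTokens Λ t 𝒜) π {(f, e)}}

/-! ## Synthesis of abstractly well-typed programs -/

/-- What the length of a path counts: all transitions, or the component transitions only. -/
inductive Measure : Type
  | transitions : Measure
  | components : Measure

/-- `1` for a component transition, `0` for a copy or delete transition. -/
def Transition.weight {K : TyCons} {Λ : Library K} : Transition Λ → ℕ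
  | .comp _ _ _ => 1
  | .copy _ => 0
  | .delete _ => 0

def pathLength {K : TyCons} {Λ : Library K} (m : Measure) (π : List (Transition Λ)) : ℕ :=
  match m with
  | .transitions => π.length
  | .components => (π.map Transition.weight).sum

/-- A shortest valid path of the net of `(Λ, t, 𝒜)`. -/
def IsShortestValidPath {K : TyCons} (m : Measure) (Λ : Library K) (t : Ty K Empty)
    (𝒜 : Set (AbsTy K)) (π : List (Transition Λ)) : Prop :=
  (atn Λ t 𝒜).ValidPath π ∧
    ∀ π', (atn Λ t 𝒜).ValidPath π' → pathLength m π ≤ pathLength m π'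

/-- `SynAbstract m Λ t 𝒜 r`: a call of `SynAbstract` may return `r`, where `none` is the
result `⊥`. The choice among shortest paths and the order of enumeration of the programs of a path
are left open. -/
inductive SynAbstract {K : TyCons} (m : Measure) (Λ : Library K) (t : Ty K Empty)
    (𝒜 : Set (AbsTy K)) : Option (Prog Λ t) → Prop
  | fail : (∀ π, ¬ (atn Λ t 𝒜).ValidPath π) → SynAbstract m Λ t 𝒜 none
  | found (π : List (Transition Λ)) (e : Prog Λ t) :
      IsShortestValidPath m Λ t 𝒜 π → e ∈ fromPath Λ t 𝒜 π → AbsCheck 𝒜 t e →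
      SynAbstract m Λ t 𝒜 (some e)

/-- The length of a program with respect to the net of `(Λ, t, 𝒜)`: the least length of a
valid path that yields it, `⊤` if there is none. -/
noncomputable def progLength {K : TyCons} (m : Measure) (Λ : Library K) (t : Ty K Empty)
    (𝒜 : Set (AbsTy K)) (e : Prog Λ t) : ℕ∞ :=
  ⨅ (π : List (Transition Λ)) (_ : (atn Λ t 𝒜).ValidPath π ∧ e ∈ fromPath Λ t 𝒜 π),
    (pathLength m π : ℕ∞)

/-! ## Refinement -/

/-- One step of the weakening loop for the arguments of `c`, where the application has the label
`R`: some label `Bⱼ ≠ ⊥` is replaced by a strictly more general one, which is accepted if still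
`⟦c⟧(B₁, …, Bₘ) ⊑ R`. -/
def WeakenStep {K : TyCons} (Λ : Library K) (c : Λ.Comp) (R : AbsTy K)
    (Bs Bs' : Fin (Λ.arity c) → AbsTy K) : Prop :=
  ∃ j B', Bs j ≠ AbsTy.bot K ∧ Bs j < B' ∧ Bs' = Function.update Bs j B' ∧ Λ.sem c Bs' ≤ R

/-- A syntax tree with a type as the label of every node. -/
inductive LTree {K : TyCons} (Λ : Library K) (n : ℕ) : Type
  | var (B : AbsTy K) (i : Fin n) : LTree Λ n
  | app (B : AbsTy K) (c : Λ.Comp) (us : Fin (Λ.arity c) → LTree Λ n) : LTree Λ n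

/-- The label of the root. -/
def LTree.label {K : TyCons} {Λ : Library K} {n : ℕ} : LTree Λ n → AbsTy K
  | .var B _ => B
  | .app B _ _ => B

/-- Replacement of the label of the root. -/
def LTree.setLabel {K : TyCons} {Λ : Library K} {n : ℕ} (B : AbsTy K) : LTree Λ n → LTree Λ n
  | .var _ i => .var B i
  | .app _ c us => .app B c us

/-- The set of all labels. -/
def LTree.range {K : TyCons} {Λ : Library K} {n : ℕ} : LTree Λ n → Set (AbsTy K)
  | .var B _ => {B}
  | .app B _ us => insert B (⋃ j, (us j).range)

/-- Every node is labelled with its concrete inferred type. -/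
noncomputable def ATm.concreteLabels {K : TyCons} {Λ : Library K} {n : ℕ} (Γ : Fin n → Ground K) :
    ATm Λ n → LTree Λ n
  | .var i => .var (.ground (Γ i)) i
  | .app c es => .app ((ATm.app c es).infer id Γ) c fun j => (es j).concreteLabels Γ

/-- `Generalize U U'`: the procedure `Generalize`, called on the labelled tree `U`, may return
`U'`. Top down, the labels of the arguments of each application are weakened; the strategy of the
weakening loop, including when it stops, is left open. -/
inductive Generalize {K : TyCons} {Λ : Library K} {n : ℕ} : LTree Λ n → LTree Λ n → Prop
  | var (B : AbsTy K) (i : Fin n) : Generalize (.var B i) (.var B i)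
  | app (B : AbsTy K) (c : Λ.Comp) (us us' : Fin (Λ.arity c) → LTree Λ n)
      (Bs : Fin (Λ.arity c) → AbsTy K) :
      Relation.ReflTransGen (WeakenStep Λ c B) (fun j => (us j).label) Bs →
      (∀ j, Generalize ((us j).setLabel (Bs j)) (us' j)) →
      Generalize (.app B c us) (.app B c us')

/-- The library `Λ` extended with a new component `r :: b → b` (here `none`). -/
def Library.addGoal {K : TyCons} (Λ : Library K) (b : Ground K) : Library K where
  Comp := Option Λ.Comp
  finite := by
    have := Λ.finite
    infer_instance
  ty
    | none => .arrow (.ofGround b) (.base (.ofGround b))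
    | some c => Λ.ty c

/-- A term over `Λ` as a term over the extended library. -/
def ATm.lift {K : TyCons} {Λ : Library K} {n : ℕ} (b : Ground K) : ATm Λ n → ATm (Λ.addGoal b) n
  | .var i => .var i
  | .app c es => .app (Λ := Λ.addGoal b) (some c) fun i => (es i).lift b

/-- The term `e* = r e`. -/
def ATm.star {K : TyCons} {Λ : Library K} {n : ℕ} (b : Ground K) (e : ATm Λ n) :
    ATm (Λ.addGoal b) n :=
  .app (Λ := Λ.addGoal b) none fun _ => e.lift b

/-- The closure of a set of types under meet. -/
inductive MeetClosure {K : TyCons} (S : Set (AbsTy K)) : AbsTy K → Prop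
  | base (A : AbsTy K) : A ∈ S → MeetClosure S A
  | meet (A B : AbsTy K) : MeetClosure S A → MeetClosure S B → MeetClosure S (A.meet B)

/-- `Refine t 𝒜 e 𝒜'`: a call of `Refine` on the cover `𝒜`, the program `e` and the query `t` may
return `𝒜'`. -/
def Refine {K : TyCons} {Λ : Library K} (t : Ty K Empty) (𝒜 : Set (AbsTy K)) (e : Prog Λ t)
    (𝒜' : Set (AbsTy K)) : Prop :=
  ∃ U, Generalize ((e.star t.res).concreteLabels t.args.get) U ∧
    𝒜' = {A | MeetClosure (𝒜 ∪ U.range) A}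

/-! ## The synthesis algorithm -/

/-- The states of `Synthesize`: at the head of the loop with the current cover, or after
`return r`, where `none` is the result `⊥`. -/
inductive State {K : TyCons} (Λ : Library K) (t : Ty K Empty) : Type
  | loop (𝒜 : Set (AbsTy K)) : State Λ t
  | returned (r : Option (Prog Λ t)) : State Λ t

/-- `Iteration m Λ t s r s'`: one iteration of the loop leads from `s` to `s'`, and `r` is the
result of `SynAbstract` in this iteration. -/
inductive Iteration {K : TyCons} (m : Measure) (Λ : Library K) (t : Ty K Empty) :
    State Λ t → Option (Prog Λ t) → State Λ t → Prop
  | fail (𝒜 : Set (AbsTy K)) :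
      SynAbstract m Λ t 𝒜 none → Iteration m Λ t (.loop 𝒜) none (.returned none)
  | success (𝒜 : Set (AbsTy K)) (e : Prog Λ t) :
      SynAbstract m Λ t 𝒜 (some e) → ConcreteCheck t e →
      Iteration m Λ t (.loop 𝒜) (some e) (.returned (some e))
  | refine (𝒜 𝒜' : Set (AbsTy K)) (e : Prog Λ t) :
      SynAbstract m Λ t 𝒜 (some e) → ¬ ConcreteCheck t e → Refine t 𝒜 e 𝒜' →
      Iteration m Λ t (.loop 𝒜) (some e) (.loop 𝒜')

/-- `Execution m Λ t s rs s'`: some sequence of iterations leads from `s` to `s'`, and `rs` lists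
the results of `SynAbstract` in these iterations. -/
inductive Execution {K : TyCons} (m : Measure) (Λ : Library K) (t : Ty K Empty) :
    State Λ t → List (Option (Prog Λ t)) → State Λ t → Prop
  | nil (s : State Λ t) : Execution m Λ t s [] s
  | cons (s₁ s₂ s₃ : State Λ t) (r : Option (Prog Λ t)) (rs : List (Option (Prog Λ t))) :
      Iteration m Λ t s₁ r s₂ → Execution m Λ t s₂ rs s₃ → Execution m Λ t s₁ (r :: rs) s₃

/-- `SynthesizeReturns m Λ t 𝒜₀ r`: some execution of `Synthesize(Λ, t, 𝒜₀)` returns `r`. -/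
def SynthesizeReturns {K : TyCons} (m : Measure) (Λ : Library K) (t : Ty K Empty)
    (𝒜₀ : Set (AbsTy K)) (r : Option (Prog Λ t)) : Prop :=
  ∃ rs, Execution m Λ t (.loop 𝒜₀) rs (.returned r)

end TYGAR

/-! `Synthesize` terminates because refinement never repeats a mistake. Finer covers infer more
specific types (`AbsCheck.anti`), a solution stays abstractly well-typed in every cover
(`ConcreteCheck.absCheck`), and a refined cover rejects the spurious program that caused the
refinement (`Refine.not_absCheck`). Hence the returned programs are pairwise distinct. A single
solution bounds their size uniformly in the cover (`ConcreteCheck.exists_bound`), and only finitely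
many programs have bounded size, so the loop stops (`Execution.invariant`, `Execution.length_le`).

For refinement, a spurious `e` gives `r e` the concrete type `⊥`. Weakening keeps each label an
upper bound of the transformer applied to the labels below it, so a cover containing all labels
infers at most the root label (`Generalize.infer_le`). That label is still `⊥`, which is impossible
if `e` checks.

For the nets, symbolic runs project to paths and paths lift to well-typed runs; conversely, a term
is run by first copying or deleting variables and then applying its components bottom-up
(`AbsCheck.exists_validPath`). That path has exactly as many component transitions as the term has
components. A potential argument, with the least size of a term for each place, shows that every
program of a path with fewest component transitions has this number as its size
(`IsShortestValidPath.size_eq`).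

The facts about types rest on the existence of most general unifiers (`exists_isMGU`): a unifier of
least cost is most general, since its anti-unification with any other unifier is again a unifier and
cannot be cheaper. -/

namespace TYGAR

/-! ### A cost for substitutions that detects proper generalization -/

section Base

variable {K : TyCons} {V W X Y : Type}

/-- The type variables of a base type, with multiplicity. -/
def Base.occs : Base K V → Multiset V
  | .var v => {v}
  | .con _ args => ∑ i, (args i).occs

/-- The number of type constructor occurrences. -/
def Base.cons : Base K V → ℕ
  | .var _ => 0
  | .con _ args => 1 + ∑ i, (args i).cons

theorem Base.subst_congr {σ ρ : V → Base K W} {B : Base K V} (h : ∀ v ∈ B.occs, σ v = ρ v) :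
    B.subst σ = B.subst ρ := by
  induction B with
  | var v => exact h v (by simp [Base.occs])
  | con C args ih =>
    simp only [Base.subst]
    congr 1
    funext i
    refine ih i fun v hv => h v ?_
    simp only [Base.occs, Multiset.mem_sum, Finset.mem_univ, true_and]
    exact ⟨i, hv⟩

theorem Base.occs_subst (σ : V → Base K W) (B : Base K V) :
    (B.subst σ).occs = B.occs.bind fun v => (σ v).occs := by
  induction B with
  | var v => simp [Base.occs, Base.subst]
  | con C args ih =>
    simp only [Base.subst, Base.occs, ih]
    exact (map_sum (⟨⟨fun O : Multiset V => O.bind fun v => (σ v).occs, Multiset.zero_bind _⟩,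
      fun s t => Multiset.add_bind s t _⟩ : Multiset V →+ Multiset W) _ _).symm

theorem Base.cons_subst (σ : V → Base K W) (B : Base K V) :
    (B.subst σ).cons = B.cons + (B.occs.map fun v => (σ v).cons).sum := by
  induction B with
  | var v => simp [Base.occs, Base.subst, Base.cons]
  | con C args ih =>
    simp only [Base.subst, Base.occs, Base.cons, ih, Finset.sum_add_distrib]
    have := map_sum (⟨⟨fun O : Multiset V => (O.map fun v => (σ v).cons).sum, by simp⟩,
      fun s t => by simp⟩ : Multiset V →+ ℕ) (fun i => (args i).occs) Finset.univ
    refine Eq.trans ?_ (congrArg (1 + ∑ i, (args i).cons + ·) this.symm)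
    simp only [← add_assoc]
    rfl

theorem Base.exists_var_of_cons_eq_zero {B : Base K V} (h : B.cons = 0) : ∃ v, B = .var v := by
  cases B with
  | var v => exact ⟨v, rfl⟩
  | con C args => simp [Base.cons] at h

theorem Base.one_le_cons_add_card_occs (B : Base K V) : 1 ≤ B.cons + Multiset.card B.occs := by
  cases B with
  | var v => simp [Base.occs]
  | con C args => simp only [Base.cons]; omega

open Classical in
/-- The number of repetitions in a multiset. -/
noncomputable def excess (O : Multiset V) : ℕ := Multiset.card O - Multiset.card O.dedup

open Classical in
theorem excess_add (O : Multiset V) : excess O + Multiset.card O.dedup = Multiset.card O :=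
  Nat.sub_add_cancel (Multiset.card_le_card (Multiset.dedup_le O))

open Classical in
theorem card_dedup_bind_le (O : Multiset V) (q : V → Multiset W) :
    Multiset.card (O.bind q).dedup ≤ (O.dedup.map fun v => Multiset.card (q v)).sum := by
  rw [← Function.comp_def, ← Multiset.card_bind]
  refine Multiset.card_le_card ((Multiset.le_iff_subset (Multiset.nodup_dedup _)).2 fun w hw => ?_)
  simp only [Multiset.mem_dedup, Multiset.mem_bind] at hw ⊢
  exact hw

open Classical in
/-- If a substitution does not increase the measure, then it is an injective renaming. -/
theorem exists_injOn_of_excess_le [Nonempty W] (O : Multiset V) (ρ : V → Base K W)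
    (h : (O.map fun v => (ρ v).cons).sum + excess (O.bind fun v => (ρ v).occs) ≤ excess O) :
    ∃ g : V → W, (∀ v ∈ O, ρ v = .var (g v)) ∧ Set.InjOn g {v | v ∈ O} := by
  obtain ⟨R, hR⟩ := Multiset.le_iff_exists_add.1 (Multiset.dedup_le O)
  have h1 := card_dedup_bind_le O fun v => (ρ v).occs
  have h2 := excess_add O
  have h3 := excess_add (O.bind fun v => (ρ v).occs)
  have h4 : Multiset.card R ≤ (R.map fun v => (ρ v).cons).sum +
      (R.map fun v => Multiset.card (ρ v).occs).sum := by
    rw [← Multiset.sum_map_add]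
    calc Multiset.card R = (R.map fun _ => 1).sum := by simp
      _ ≤ _ := Multiset.sum_map_le_sum_map _ _ fun v _ => (ρ v).one_le_cons_add_card_occs
  have h10 : Multiset.card O.dedup ≤ (O.dedup.map fun v => (ρ v).cons).sum +
      (O.dedup.map fun v => Multiset.card (ρ v).occs).sum := by
    rw [← Multiset.sum_map_add]
    calc Multiset.card O.dedup = (O.dedup.map fun _ => 1).sum := by simp
      _ ≤ _ := Multiset.sum_map_le_sum_map _ _ fun v _ => (ρ v).one_le_cons_add_card_occs
  have h5 : Multiset.card O = Multiset.card O.dedup + Multiset.card R := by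
    conv_lhs => rw [hR]
    simp
  have h6 : (O.map fun v => (ρ v).cons).sum =
      (O.dedup.map fun v => (ρ v).cons).sum + (R.map fun v => (ρ v).cons).sum := by
    conv_lhs => rw [hR]
    simp
  have h7 : Multiset.card (O.bind fun v => (ρ v).occs) =
      (O.dedup.map fun v => Multiset.card (ρ v).occs).sum +
        (R.map fun v => Multiset.card (ρ v).occs).sum := by
    conv_lhs => rw [hR]
    simp [Multiset.card_bind]
  -- The images of the surplus occurrences `R` each contain a symbol, and by `h1` they alone use up
  -- the whole budget `excess O`. Nothing is left for constructors in the images of the distinct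
  -- variables.
  have h8 : (O.dedup.map fun v => (ρ v).cons).sum = 0 := by omega
  have h9 : ∀ v ∈ O, ∃ w, ρ v = .var w := fun v hv =>
    Base.exists_var_of_cons_eq_zero <| Multiset.sum_eq_zero_iff.1 h8 _
      (Multiset.mem_map_of_mem _ (Multiset.mem_dedup.2 hv))
  choose! g hg using h9
  refine ⟨g, hg, ?_⟩
  have hbind : (O.bind fun v => (ρ v).occs) = O.map g := by
    rw [Multiset.bind_congr (g := fun v => {g v}) fun v hv => by rw [hg v hv]; rfl,
      Multiset.bind_singleton]
  -- Renaming keeps the number of occurrences, and the number of repetitions does not grow, so no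
  -- two variables can have been identified.
  have hcard : (O.toFinset.image g).card = O.toFinset.card := by
    refine le_antisymm Finset.card_image_le ?_
    rw [← Multiset.toFinset_map, Multiset.card_toFinset, Multiset.card_toFinset, ← hbind]
    omega
  exact fun v hv w hw hvw =>
    Finset.card_image_iff.1 hcard (by simpa using hv) (by simpa using hw) hvw

/-- A measure of a finite family of base types that is strictly decreased by proper
generalization. -/
noncomputable def cost (S : Finset V) (θ : V → Base K W) : ℕ :=
  ∑ v ∈ S, (θ v).cons + excess (∑ v ∈ S, (θ v).occs)

theorem cost_subst (S : Finset V) (θ : V → Base K W) (ρ : W → Base K X) :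
    cost S (fun v => (θ v).subst ρ) = ∑ v ∈ S, (θ v).cons +
      (((∑ v ∈ S, (θ v).occs).map fun w => (ρ w).cons).sum +
        excess ((∑ v ∈ S, (θ v).occs).bind fun w => (ρ w).occs)) := by
  have h1 := map_sum (⟨⟨fun O : Multiset W => (O.map fun v => (ρ v).cons).sum, by simp⟩,
      fun s t => by simp⟩ : Multiset W →+ ℕ) (fun v => (θ v).occs) S
  have h2 := map_sum (⟨⟨fun O : Multiset W => O.bind fun v => (ρ v).occs, Multiset.zero_bind _⟩,
      fun s t => Multiset.add_bind s t _⟩ : Multiset W →+ Multiset X) (fun v => (θ v).occs) S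
  simp only [AddMonoidHom.coe_mk, ZeroHom.coe_mk] at h1 h2
  rw [cost, ← add_assoc]
  simp only [Base.occs_subst, Base.cons_subst, Finset.sum_add_distrib]
  congr 1
  · exact congrArg _ h1.symm
  · exact congrArg _ h2.symm

/-- A substitution that does not raise the cost only renames the occurring variables, injectively,
and so can be undone on them. -/
theorem exists_inverse_of_cost_subst_le [Nonempty W] [Nonempty X] (S : Finset V)
    (θ : V → Base K W) (ρ : W → Base K X) (h : cost S (fun v => (θ v).subst ρ) ≤ cost S θ) :
    ∃ ρ' : X → Base K W, ∀ v ∈ S, ((θ v).subst ρ).subst ρ' = θ v := by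
  rw [cost_subst, cost] at h
  obtain ⟨g, hg, hinj⟩ := exists_injOn_of_excess_le _ ρ (Nat.le_of_add_le_add_left h)
  refine ⟨fun x => .var (Function.invFunOn g {w | w ∈ ∑ v ∈ S, (θ v).occs} x), fun v hv => ?_⟩
  rw [Base.subst_subst]
  refine Eq.trans (Base.subst_congr fun w hw => ?_) (Base.subst_var _)
  have hw' : w ∈ ∑ v ∈ S, (θ v).occs := Multiset.mem_sum.2 ⟨v, hv, hw⟩
  rw [hg w hw', Base.subst]
  exact congrArg _ (hinj.leftInvOn_invFunOn hw')

/-! ## Anti-unification and most general unifiers -/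

open Classical in
/-- Anti-unification: the least general generalization of two base types, with pairs of types as
variables. -/
noncomputable def Base.au : Base K X → Base K Y → Base K (Base K X × Base K Y)
  | .con C as, .con D bs =>
      if h : C = D then .con C fun i => (as i).au (bs (h ▸ i)) else .var (.con C as, .con D bs)
  | .var x, B => .var (.var x, B)
  | .con C as, .var y => .var (.con C as, .var y)

theorem Base.au_con (C : K.Con) (as : Fin (K.arity C) → Base K X)
    (bs : Fin (K.arity C) → Base K Y) :
    (Base.con C as).au (.con C bs) = .con C fun i => (as i).au (bs i) := by
  simp [Base.au]

/-- A variable of the generalization is the very pair of subterms that it replaces, so the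
projections recover the two types. -/
theorem Base.au_subst_fst (A : Base K X) (B : Base K Y) : (A.au B).subst Prod.fst = A := by
  induction A generalizing B with
  | var x => cases B <;> rfl
  | con C as ih =>
    cases B with
    | var y => rfl
    | con D bs =>
      by_cases h : C = D
      · subst h
        simp [Base.au_con, Base.subst, ih]
      · simp [Base.au, h, Base.subst]

theorem Base.au_subst_snd (A : Base K X) (B : Base K Y) : (A.au B).subst Prod.snd = B := by
  induction A generalizing B with
  | var x => cases B <;> rfl
  | con C as ih =>
    cases B with
    | var y => rfl
    | con D bs =>
      by_cases h : C = D
      · subst h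
        simp [Base.au_con, Base.subst, ih]
      · simp [Base.au, h, Base.subst]

/-- Two instances of `A` share its skeleton and can differ only inside the substituted parts.
Consequently the anti-unification of two unifiers is a unifier. -/
theorem Base.subst_au_subst (A : Base K V) (θ₁ : V → Base K X) (θ₂ : V → Base K Y) :
    (A.subst θ₁).au (A.subst θ₂) = A.subst fun v => (θ₁ v).au (θ₂ v) := by
  induction A with
  | var v => rfl
  | con C args ih => simp [Base.subst, Base.au_con, ih]

/-- Every unifiable finite family of pairs has a most general unifier. -/
theorem exists_isMGU {ι : Type} [Finite ι] [Countable V] (eqs : ι → Base K V × Base K V)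
    (h : ∃ θ : V → Base K ℕ, Unifies θ eqs) : ∃ σ, IsMGU σ eqs := by
  classical
  have := Fintype.ofFinite ι
  let S : Finset V := (∑ i, ((eqs i).1.occs + (eqs i).2.occs)).toFinset
  have hS1 : ∀ i, ∀ v ∈ (eqs i).1.occs, v ∈ S := fun i v hv =>
    Multiset.mem_toFinset.2 <| Multiset.mem_sum.2
      ⟨i, Finset.mem_univ _, Multiset.mem_add.2 (.inl hv)⟩
  have hS2 : ∀ i, ∀ v ∈ (eqs i).2.occs, v ∈ S := fun i v hv =>
    Multiset.mem_toFinset.2 <| Multiset.mem_sum.2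
      ⟨i, Finset.mem_univ _, Multiset.mem_add.2 (.inr hv)⟩
  -- The minimum ranges over all variable types, because it is compared with a unifier whose
  -- variables are pairs of types.
  have hex : ∃ n, ∃ (X : Type) (_ : Nonempty X) (θ : V → Base K X),
      (∀ i, (eqs i).1.subst θ = (eqs i).2.subst θ) ∧ cost S θ = n := by
    obtain ⟨θ, hθ⟩ := h
    exact ⟨_, ℕ, inferInstance, θ, hθ, rfl⟩
  obtain ⟨X, hX, θ₀, hθ₀, hcost⟩ := Nat.find_spec hex
  have hmin : ∀ (Z : Type) [Nonempty Z] (γ : V → Base K Z),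
      (∀ i, (eqs i).1.subst γ = (eqs i).2.subst γ) → cost S θ₀ ≤ cost S γ := fun Z _ γ hγ =>
    hcost ▸ Nat.find_min' hex ⟨Z, inferInstance, γ, hγ, rfl⟩
  have hmost : ∀ θ : V → Base K ℕ, Unifies θ eqs →
      ∃ ρ : X → Base K ℕ, ∀ v ∈ S, θ v = (θ₀ v).subst ρ := by
    intro θ hθ
    have : Nonempty (Base K X × Base K ℕ) := ⟨.var hX.some, .var 0⟩
    -- By minimality the first projection does not raise the cost, so it is invertible: go from `θ₀`
    -- back to the generalization, then by the second projection to `θ`.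
    obtain ⟨ρ', hρ'⟩ := exists_inverse_of_cost_subst_le S (fun v => (θ₀ v).au (θ v)) Prod.fst (by
      simp only [Base.au_subst_fst]
      refine hmin _ _ fun i => ?_
      rw [← Base.subst_au_subst, ← Base.subst_au_subst, hθ₀ i, hθ i])
    refine ⟨fun x => (ρ' x).subst Prod.snd, fun v hv => ?_⟩
    have h1 := hρ' v hv
    rw [Base.au_subst_fst] at h1
    rw [← Base.subst_subst, h1, Base.au_subst_snd]
  let T : Set X := {x | ∃ v ∈ S, x ∈ (θ₀ v).occs}
  have hT : T.Finite := by
    have : T = ⋃ v ∈ S, {x | x ∈ (θ₀ v).occs} := by ext; simp [T]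
    rw [this]
    refine S.finite_toSet.biUnion fun v _ => ?_
    exact (Multiset.toFinset (θ₀ v).occs).finite_toSet.subset fun x hx => by simpa using hx
  obtain ⟨g, hg⟩ := Set.countable_iff_exists_injOn.1 hT.countable
  obtain ⟨f, hf⟩ := exists_injective_nat V
  have hV : ∀ v : V, Nonempty V := fun v => ⟨v⟩
  -- An mgu must factor `θ` at every variable, also outside the equations. Even numbers name the
  -- variables of `θ₀` on `S`; each variable outside `S` gets an odd number of its own, whose value
  -- can be prescribed freely.
  let σ : V → Base K ℕ := fun v =>
    if v ∈ S then (θ₀ v).rename fun x => 2 * g x else .var (2 * f v + 1)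
  have hσ : ∀ v ∈ S, σ v = (θ₀ v).rename fun x => 2 * g x := fun v hv => if_pos hv
  refine ⟨σ, fun i => ?_, fun θ hθ => ?_⟩
  · rw [Base.subst_congr fun v hv => hσ v (hS1 i v hv),
      Base.subst_congr fun v hv => hσ v (hS2 i v hv)]
    simp only [Base.rename]
    rw [← Base.subst_subst, ← Base.subst_subst, hθ₀ i]
  · obtain ⟨ρ, hρ⟩ := hmost θ hθ
    refine ⟨fun k => if k % 2 = 0 then ρ (Function.invFunOn g T (k / 2)) else
      if h : ∃ v, f v = k / 2 then θ h.choose else .var 0, fun v => ?_⟩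
    by_cases hv : v ∈ S
    · rw [hσ v hv, hρ v hv, Base.rename, Base.subst_subst]
      refine Base.subst_congr fun x hx => ?_
      have hx' : x ∈ T := ⟨v, hv, hx⟩
      simp [Base.subst, hg.leftInvOn_invFunOn hx']
    · have h1 : (2 * f v + 1) % 2 ≠ 0 := by omega
      have h2 : (2 * f v + 1) / 2 = f v := by omega
      have h3 : ∃ w, f w = f v := ⟨v, rfl⟩
      simp only [σ, hv, if_false, Base.subst, h1, h2, dif_pos h3]
      rw [hf h3.choose_spec]

end Base

/-! ### The subsumption lattice, described by the proper types below each element -/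

section Lattice

variable {K : TyCons}

/-- The class of a proper base type. -/
def AbsTy.of (B : Base K ℕ) : AbsTy K := .mk (B : WithBot (Base K ℕ))

theorem AbsTy.mk_le_mk {A B : WithBot (Base K ℕ)} : AbsTy.mk A ≤ AbsTy.mk B ↔ A ≤ B :=
  toAntisymmetrization_le_toAntisymmetrization_iff

theorem AbsTy.of_le_of {A B : Base K ℕ} :
    AbsTy.of A ≤ AbsTy.of B ↔ ∃ σ : ℕ → Base K ℕ, A = B.subst σ :=
  AbsTy.mk_le_mk.trans WithBot.coe_le_coe

theorem AbsTy.mk_rep (A : AbsTy K) : AbsTy.mk A.rep = A :=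
  toAntisymmetrization_ofAntisymmetrization _ A

theorem AbsTy.bot_le (A : AbsTy K) : AbsTy.bot K ≤ A := by
  rw [← A.mk_rep]
  exact AbsTy.mk_le_mk.2 _root_.bot_le

theorem AbsTy.not_of_le_bot (B : Base K ℕ) : ¬ AbsTy.of B ≤ AbsTy.bot K := fun h =>
  WithBot.not_coe_le_bot _ (AbsTy.mk_le_mk.1 h)

theorem AbsTy.eq_bot_or_of (A : AbsTy K) : A = AbsTy.bot K ∨ ∃ B, A = AbsTy.of B := by
  rw [← A.mk_rep]
  cases A.rep with
  | bot => exact .inl rfl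
  | coe B => exact .inr ⟨B, rfl⟩

theorem AbsTy.rep_eq_bot_iff {A : AbsTy K} : A.rep = ⊥ ↔ A = AbsTy.bot K := by
  constructor
  · intro h
    rw [← A.mk_rep, h]
    rfl
  · intro h
    have : AbsTy.mk A.rep ≤ AbsTy.mk (⊥ : WithBot (Base K ℕ)) := by
      rw [A.mk_rep, h]
      exact le_refl _
    have := AbsTy.mk_le_mk.1 this
    cases hA : A.rep with
    | bot => rfl
    | coe B =>
      rw [hA] at this
      exact (WithBot.not_coe_le_bot _ this).elim

/-- Only `⊥` is not proper, so a class is determined by the proper types below it. Meets and type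
transformers are handled through this description, independently of representatives. -/
theorem AbsTy.le_iff {A A' : AbsTy K} :
    A ≤ A' ↔ ∀ B : Base K ℕ, AbsTy.of B ≤ A → AbsTy.of B ≤ A' := by
  refine ⟨fun h B hB => hB.trans h, fun h => ?_⟩
  obtain rfl | ⟨B, rfl⟩ := A.eq_bot_or_of
  · exact A'.bot_le
  · exact h B le_rfl

theorem AbsTy.le_top (A : AbsTy K) : A ≤ AbsTy.top K :=
  AbsTy.le_iff.2 fun B _ => AbsTy.of_le_of.2 ⟨fun _ => B, rfl⟩

/-- The unifiers are exactly the instances of an mgu, and if there is no mgu then nothing unifies.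
This makes the choice inside `applyMGU` irrelevant. -/
theorem of_le_mk_applyMGU {V ι : Type} [Finite ι] [Countable V]
    (eqs : ι → Base K V × Base K V) (C : Base K V) (B : Base K ℕ) :
    AbsTy.of B ≤ AbsTy.mk (applyMGU eqs C) ↔
      ∃ θ : V → Base K ℕ, Unifies θ eqs ∧ B = C.subst θ := by
  unfold applyMGU
  split_ifs with h
  · refine AbsTy.of_le_of.trans ⟨?_, ?_⟩
    · rintro ⟨ρ, rfl⟩
      refine ⟨fun v => (h.choose v).subst ρ, fun i => ?_, Base.subst_subst _ _ _⟩
      rw [← Base.subst_subst, ← Base.subst_subst, h.choose_spec.1 i]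
    · rintro ⟨θ, hθ, rfl⟩
      obtain ⟨ρ, hρ⟩ := h.choose_spec.2 θ hθ
      exact ⟨ρ, by rw [Base.subst_subst, ← funext hρ]⟩
  · exact ⟨fun hB => (AbsTy.not_of_le_bot B hB).elim, fun ⟨θ, hθ, _⟩ =>
      (h (exists_isMGU eqs ⟨θ, hθ⟩)).elim⟩

theorem Base.subst_rename {V W X : Type} (f : V → W) (σ : W → Base K X) (B : Base K V) :
    (B.rename f).subst σ = B.subst fun v => σ (f v) :=
  Base.subst_subst _ _ _

/-- With variables renamed apart, two instantiations with the common value `B` glue to one unifier.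
-/
theorem AbsTy.of_le_meet {A A' : AbsTy K} {B : Base K ℕ} :
    AbsTy.of B ≤ A.meet A' ↔ AbsTy.of B ≤ A ∧ AbsTy.of B ≤ A' := by
  conv_rhs => rw [← A.mk_rep, ← A'.mk_rep]
  unfold AbsTy.meet
  cases A.rep with
  | bot =>
    exact ⟨fun h => (AbsTy.not_of_le_bot B h).elim, fun h => (AbsTy.not_of_le_bot B h.1).elim⟩
  | coe A =>
    cases A'.rep with
    | bot =>
      exact ⟨fun h => (AbsTy.not_of_le_bot B h).elim, fun h => (AbsTy.not_of_le_bot B h.2).elim⟩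
    | coe A' =>
      refine (of_le_mk_applyMGU _ _ B).trans ?_
      simp only [Unifies, Base.subst_rename]
      refine Iff.trans ⟨?_, ?_⟩ (and_congr AbsTy.of_le_of.symm AbsTy.of_le_of.symm)
      · rintro ⟨θ, hθ, rfl⟩
        exact ⟨⟨_, rfl⟩, ⟨_, hθ ()⟩⟩
      · rintro ⟨⟨σ, rfl⟩, ⟨ρ, hρ⟩⟩
        exact ⟨Sum.elim σ ρ, fun _ => hρ, rfl⟩

theorem AbsTy.le_meet {A B C : AbsTy K} (hB : A ≤ B) (hC : A ≤ C) : A ≤ B.meet C :=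
  AbsTy.le_iff.2 fun _ hX => AbsTy.of_le_meet.2 ⟨hX.trans hB, hX.trans hC⟩

theorem AbsTy.meet_le_left (A B : AbsTy K) : A.meet B ≤ A :=
  AbsTy.le_iff.2 fun _ hX => (AbsTy.of_le_meet.1 hX).1

theorem AbsTy.meet_le_right (A B : AbsTy K) : A.meet B ≤ B :=
  AbsTy.le_iff.2 fun _ hX => (AbsTy.of_le_meet.1 hX).2

/-- The subsumption lattice is a meet-semilattice. -/
noncomputable abbrev AbsTy.semilatticeInf (K : TyCons) : SemilatticeInf (AbsTy K) where
  inf := AbsTy.meet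
  inf_le_left := AbsTy.meet_le_left
  inf_le_right := AbsTy.meet_le_right
  le_inf _ _ _ := AbsTy.le_meet

theorem MeetClosure.finite {S : Set (AbsTy K)} (hS : S.Finite) : {A | MeetClosure S A}.Finite := by
  let := AbsTy.semilatticeInf K
  refine hS.infClosure.subset fun A hA => ?_
  induction hA with
  | base A hA => exact subset_infClosure hA
  | meet A B _ _ hA hB => exact infClosed_infClosure hA hB

/-- There are no infinite chains of proper generalizations. -/
instance AbsTy.wellFoundedGT (K : TyCons) : WellFoundedGT (AbsTy K) := by
  -- Proper generalization lowers the cost, since otherwise the instance could be renamed back. As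
  -- the most specific element, `⊥` gets the value `⊤`.
  let ν : AbsTy K → WithTop ℕ := fun A => match A.rep with
    | some B => ((cost {()} fun _ => B : ℕ) : WithTop ℕ)
    | none => ⊤
  refine ⟨Subrelation.wf (r := InvImage (· < ·) ν) ?_ (InvImage.wf _ wellFounded_lt)⟩
  intro A A' h
  have h' : A' < A := h
  rw [← A.mk_rep, ← A'.mk_rep] at h'
  change ν A < ν A'
  simp only [ν]
  revert h'
  cases hA : A.rep with
  | bot =>
    intro h'
    exact (h'.not_ge (AbsTy.bot_le _)).elim
  | coe B =>
    cases hA' : A'.rep with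
    | bot =>
      intro _
      exact WithTop.coe_lt_top _
    | coe B' =>
      intro h'
      obtain ⟨σ, rfl⟩ := AbsTy.of_le_of.1 h'.le
      refine WithTop.coe_lt_coe.2 (lt_of_not_ge fun hle => h'.not_ge ?_)
      obtain ⟨ρ, hρ⟩ := exists_inverse_of_cost_subst_le {()} (fun _ => B) σ hle
      exact AbsTy.of_le_of.2 ⟨ρ, (hρ () (Finset.mem_singleton_self _)).symm⟩

/-! ## Ground types -/

theorem Base.ofGround_subst (b : Ground K) (σ : ℕ → Base K ℕ) :
    (Base.ofGround b).subst σ = Base.ofGround b := by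
  rw [Base.ofGround, Base.subst_subst]
  exact congrArg (b.subst ·) (funext fun v => v.elim)

theorem Base.ofGround_subst_ground (b : Ground K) (σ : ℕ → Ground K) :
    (Base.ofGround b).subst σ = b := by
  rw [Base.ofGround, Base.subst_subst]
  refine Eq.trans (congrArg (b.subst ·) (funext fun v => v.elim)) b.subst_var

theorem Base.ofGround_injective : Function.Injective (Base.ofGround (K := K)) := fun b b' h => by
  rw [← Base.ofGround_subst_ground b fun _ => b, h, Base.ofGround_subst_ground]

theorem AbsTy.ground_le_ground {b b' : Ground K} :
    AbsTy.ground b ≤ AbsTy.ground b' ↔ b = b' := by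
  refine ⟨fun h => ?_, fun h => h ▸ le_rfl⟩
  obtain ⟨σ, hσ⟩ := AbsTy.of_le_of.1 h
  rw [Base.ofGround_subst] at hσ
  exact Base.ofGround_injective hσ

theorem AbsTy.not_ground_le_bot (b : Ground K) : ¬ AbsTy.ground b ≤ AbsTy.bot K :=
  AbsTy.not_of_le_bot _

/-! ## The type transformer -/

variable {Λ : Library K}

/-- A unifier splits into an instantiation `σ` of the type of `c` and, for each argument, a
substitution witnessing that the instantiated parameter lies below `As i`. -/
theorem Library.of_le_sem {c : Λ.Comp} {As : Fin (Λ.arity c) → AbsTy K} {B : Base K ℕ} :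
    AbsTy.of B ≤ Λ.sem c As ↔ ∃ σ : ℕ → Base K ℕ, B = (Λ.ty c).res.subst σ ∧
      ∀ i, AbsTy.of (((Λ.ty c).args.get i).subst σ) ≤ As i := by
  unfold Library.sem Library.semRep
  split_ifs with h
  · have hA : ∀ i, AbsTy.of (((As i).rep).unbot (h i)) = As i := fun i => by
      conv_rhs => rw [← (As i).mk_rep]
      rw [AbsTy.of, WithBot.coe_unbot]
    refine (of_le_mk_applyMGU _ _ B).trans ?_
    simp only [Unifies, Base.subst_rename]
    constructor
    · rintro ⟨θ, hθ, rfl⟩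
      refine ⟨fun v => θ (.inl v), rfl, fun i => ?_⟩
      rw [← hθ i]
      exact (AbsTy.of_le_of.2 ⟨_, rfl⟩).trans_eq (hA i)
    · rintro ⟨σ, rfl, hσ⟩
      have : ∀ i, ∃ ρ : ℕ → Base K ℕ, ((Λ.ty c).args.get i).subst σ =
          (((As i).rep).unbot (h i)).subst ρ := fun i => by
        have := hσ i
        rw [← hA i] at this
        exact AbsTy.of_le_of.1 this
      choose ρ hρ using this
      exact ⟨Sum.elim σ fun x => ρ x.1 x.2, fun i => (hρ i).symm, rfl⟩
  · refine ⟨fun hB => (AbsTy.not_of_le_bot B hB).elim, fun ⟨σ, _, hσ⟩ => (h fun i hi => ?_).elim⟩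
    have := hσ i
    rw [AbsTy.rep_eq_bot_iff.1 hi] at this
    exact AbsTy.not_of_le_bot _ this

theorem Library.sem_mono {c : Λ.Comp} {As As' : Fin (Λ.arity c) → AbsTy K}
    (h : ∀ i, As i ≤ As' i) : Λ.sem c As ≤ Λ.sem c As' :=
  AbsTy.le_iff.2 fun _ hB => by
    obtain ⟨σ, hB, hσ⟩ := Library.of_le_sem.1 hB
    exact Library.of_le_sem.2 ⟨σ, hB, fun i => (hσ i).trans (h i)⟩

theorem Library.sem_eq_bot {c : Λ.Comp} {As : Fin (Λ.arity c) → AbsTy K} {i : Fin (Λ.arity c)}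
    (h : As i = AbsTy.bot K) : Λ.sem c As = AbsTy.bot K := by
  refine le_antisymm (AbsTy.le_iff.2 fun B hB => ?_) (AbsTy.bot_le _)
  obtain ⟨σ, _, hσ⟩ := Library.of_le_sem.1 hB
  have := hσ i
  rw [h] at this
  exact (AbsTy.not_of_le_bot _ this).elim

/-! ## Abstraction -/

variable {𝒜 𝒜' : Set (AbsTy K)} {A B : AbsTy K}

/-- A minimal member above `B` exists by finiteness; its meet with any other such member is again
one, so it is least. -/
theorem IsCover.isLeast_abstr (h𝒜 : IsCover 𝒜) (B : AbsTy K) :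
    IsLeast {A | A ∈ 𝒜 ∧ B ≤ A} (abstr 𝒜 B) := by
  have hex : ∃ A, IsLeast {A | A ∈ 𝒜 ∧ B ≤ A} A := by
    have hfin : {A | A ∈ 𝒜 ∧ B ≤ A}.Finite := h𝒜.finite.subset fun A hA => hA.1
    obtain ⟨A, hA⟩ := hfin.exists_minimal ⟨_, h𝒜.top_mem, B.le_top⟩
    refine ⟨A, hA.prop, fun A' hA' => ?_⟩
    have := hA.le_of_le ⟨h𝒜.meet_mem A hA.prop.1 A' hA'.1, AbsTy.le_meet hA.prop.2 hA'.2⟩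
      (AbsTy.meet_le_left A A')
    exact this.trans (AbsTy.meet_le_right A A')
  rw [abstr, dif_pos hex]
  exact hex.choose_spec

theorem IsCover.abstr_mem (h𝒜 : IsCover 𝒜) (B : AbsTy K) : abstr 𝒜 B ∈ 𝒜 :=
  (h𝒜.isLeast_abstr B).1.1

theorem IsCover.le_abstr (h𝒜 : IsCover 𝒜) (B : AbsTy K) : B ≤ abstr 𝒜 B :=
  (h𝒜.isLeast_abstr B).1.2

theorem IsCover.abstr_le (h𝒜 : IsCover 𝒜) (hA : A ∈ 𝒜) (h : B ≤ A) : abstr 𝒜 B ≤ A :=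
  (h𝒜.isLeast_abstr B).2 ⟨hA, h⟩

theorem IsCover.abstr_bot (h𝒜 : IsCover 𝒜) : abstr 𝒜 (AbsTy.bot K) = AbsTy.bot K :=
  le_antisymm (h𝒜.abstr_le h𝒜.bot_mem le_rfl) (AbsTy.bot_le _)

/-! ## Type inference -/

variable {n : ℕ} {Γ : Fin n → Ground K} {t : Ty K Empty}

/-- Finer covers infer more specific types. -/
theorem ATm.infer_abstr_anti (h𝒜 : IsCover 𝒜) (h𝒜' : IsCover 𝒜') (h : 𝒜 ⊆ 𝒜') (e : ATm Λ n) :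
    e.infer (abstr 𝒜') Γ ≤ e.infer (abstr 𝒜) Γ := by
  induction e with
  | var i => exact h𝒜'.abstr_le (h (h𝒜.abstr_mem _)) (h𝒜.le_abstr _)
  | app c es ih =>
    exact h𝒜'.abstr_le (h (h𝒜.abstr_mem _)) ((Library.sem_mono ih).trans (h𝒜.le_abstr _))

/-- Abstract inference overapproximates concrete inference. -/
theorem ATm.infer_id_le (h𝒜 : IsCover 𝒜) (e : ATm Λ n) : e.infer id Γ ≤ e.infer (abstr 𝒜) Γ := by
  induction e with
  | var i => exact h𝒜.le_abstr _
  | app c es ih => exact (Library.sem_mono ih).trans (h𝒜.le_abstr _)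

theorem AbsCheck.anti (h𝒜 : IsCover 𝒜) (h𝒜' : IsCover 𝒜') (h : 𝒜 ⊆ 𝒜') {e : Prog Λ t}
    (he : AbsCheck 𝒜' t e) : AbsCheck 𝒜 t e :=
  le_trans he (e.infer_abstr_anti h𝒜 h𝒜' h)

theorem ConcreteCheck.absCheck (h𝒜 : IsCover 𝒜) {e : Prog Λ t} (he : ConcreteCheck t e) :
    AbsCheck 𝒜 t e :=
  le_trans he (e.infer_id_le h𝒜)

theorem ATm.infer_abstr_mem (h𝒜 : IsCover 𝒜) (e : ATm Λ n) : e.infer (abstr 𝒜) Γ ∈ 𝒜 := by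
  cases e <;> exact h𝒜.abstr_mem _

end Lattice

/-! ### Concrete checking versus declarative typing -/

section Typing

variable {K : TyCons} {Λ : Library K}

theorem Ty.args_subst {V W : Type} (σ : V → Base K W) (T : Ty K V) :
    (T.subst σ).args = T.args.map (Base.subst σ) := by
  induction T with
  | base B => rfl
  | arrow B T ih => simp [Ty.subst, Ty.args, ih]

theorem Ty.res_subst {V W : Type} (σ : V → Base K W) (T : Ty K V) :
    (T.subst σ).res = T.res.subst σ := by
  induction T with
  | base B => rfl
  | arrow B T ih => simpa [Ty.subst, Ty.res] using ih

theorem Base.ofGround_subst_comp {V : Type} (B : Base K V) (σ : V → Ground K) :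
    Base.ofGround (B.subst σ) = B.subst fun v => Base.ofGround (σ v) :=
  Base.subst_subst _ _ _

theorem Typing.foldl_app {Γ : List (Ground K)} {T : Ty K Empty} {f : Tm Λ} {es : List (Tm Λ)}
    (hf : Typing Λ Γ f T) (hes : List.Forall₂ (fun e b => Typing Λ Γ e (.base b)) es T.args) :
    Typing Λ Γ (es.foldl Tm.app f) (.base T.res) := by
  induction T generalizing f es with
  | base B =>
    cases hes
    exact hf
  | arrow B T ih =>
    cases hes with
    | cons he hes => exact ih (f := .app f _) (.app _ _ _ _ hf he) hes

theorem Typing.of_ground_le_infer {Γ : List (Ground K)} {e : ATm Λ Γ.length} {b : Ground K}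
    (h : AbsTy.ground b ≤ e.infer id Γ.get) : Typing Λ Γ e.curry (.base b) := by
  induction e generalizing b with
  | var i =>
    refine .var _ _ ?_
    rw [AbsTy.ground_le_ground.1 h]
    simp
  | app c es ih =>
    obtain ⟨σ, hb, hσ⟩ := Library.of_le_sem.1 h
    -- The instantiation `σ` may leave variables, which declarative typing forbids. They are filled
    -- with `b`, which is at hand even though ground types need not exist in general.
    let δ : ℕ → Ground K := fun _ => b
    have hres : b = ((Λ.ty c).subst fun v => (σ v).subst δ).res := by
      rw [Ty.res_subst, ← Base.subst_subst, ← hb, Base.ofGround_subst_ground]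
    rw [hres]
    refine Typing.foldl_app (.comp c _) (List.forall₂_iff_get.2 ⟨?_, fun i h₁ h₂ => ?_⟩)
    · simp [Ty.args_subst, Library.arity]
    · have hi : i < Λ.arity c := by simpa using h₁
      simp only [List.get_eq_getElem, List.getElem_ofFn, Ty.args_subst, List.getElem_map]
      refine ih ⟨i, hi⟩ (le_trans ?_ (hσ ⟨i, hi⟩))
      refine AbsTy.of_le_of.2 ⟨fun v => Base.ofGround (δ v), ?_⟩
      rw [← Base.subst_subst, Base.ofGround_subst_comp]
      rfl

theorem NTyping.of_typing {T : Ty K Empty} {Γ : List (Ground K)} {f : Tm Λ}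
    (h : Typing Λ (Γ ++ T.args) f (.base T.res)) :
    NTyping Λ Γ (NTm.lam^[T.args.length] (.body f)) T := by
  induction T generalizing Γ with
  | base B => exact .body _ _ _ (by simpa [Ty.args, Ty.res] using h)
  | arrow B T ih =>
    rw [Ty.args, List.length_cons, Function.iterate_succ_apply']
    exact .lam _ _ _ _ (ih (by simpa [Ty.args, Ty.res] using h))

/-- Concrete checking is sound for declarative typing. -/
theorem ConcreteCheck.nTyping {t : Ty K Empty} {e : Prog Λ t} (h : ConcreteCheck t e) :
    NTyping Λ [] e.close t :=
  NTyping.of_typing (Typing.of_ground_le_infer h)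

/-- The `η`-long form of an application term, applied to given arguments. -/
theorem Typing.exists_etaLong {Γ L : List (Ground K)} {f : Tm Λ} {T : Ty K Empty}
    (h : Typing Λ Γ f T) (hL : ∀ (i : ℕ) b, Γ[i]? = some b → L[i]? = some b)
    (es : List (ATm Λ L.length))
    (hes : List.Forall₂ (fun e b => AbsTy.ground b ≤ e.infer id L.get) es T.args) :
    ∃ e : ATm Λ L.length, AbsTy.ground T.res ≤ e.infer id L.get ∧
      e.size = f.size + (es.map ATm.size).sum := by
  induction h generalizing es with
  | var i b hb =>
    cases hes
    obtain ⟨hi, hb⟩ := List.getElem?_eq_some_iff.1 (hL i b hb)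
    exact ⟨.var ⟨i, hi⟩, AbsTy.ground_le_ground.2 hb.symm, rfl⟩
  | comp c σ =>
    have hlen : es.length = Λ.arity c := by
      rw [hes.length_eq, Ty.args_subst, List.length_map]
      rfl
    obtain ⟨g, rfl⟩ : ∃ g : Fin (Λ.arity c) → ATm Λ L.length, es = List.ofFn g :=
      ⟨fun i => es.get (i.cast hlen.symm), List.ext_getElem (by simp [hlen]) (by simp)⟩
    refine ⟨.app c g, ?_, ?_⟩
    · refine Library.of_le_sem.2 ⟨fun v => Base.ofGround (σ v), ?_, fun i => ?_⟩
      · rw [Ty.res_subst, Base.ofGround_subst_comp]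
      · have := (List.forall₂_iff_get.1 hes).2 i (by rw [List.length_ofFn]; exact i.2)
          (by simp [Ty.args_subst])
        simp only [List.get_eq_getElem, List.getElem_ofFn, Ty.args_subst, List.getElem_map] at this
        refine le_trans ?_ this
        rw [AbsTy.ground, Base.ofGround_subst_comp]
        exact le_rfl
    · simp [ATm.size, Tm.size, List.sum_ofFn, List.map_ofFn]
  | app f₁ f₂ b T _ _ ih₁ ih₂ =>
    -- The argument has base type and awaits nothing; the function then takes it as the first of its
    -- pending arguments.
    obtain ⟨e₂, h₂, hs₂⟩ := ih₂ [] .nil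
    obtain ⟨e, he, hs⟩ := ih₁ (e₂ :: es) (.cons h₂ hes)
    refine ⟨e, he, ?_⟩
    simp only [hs, List.map_cons, List.sum_cons, hs₂, Tm.size, List.map_nil, List.sum_nil]
    omega

/-- A `λ` only moves a type from `T` to `Γ`, so `Γ ++ T.args` serves as a single context for the
whole derivation. -/
theorem NTyping.exists_etaLong {Γ : List (Ground K)} {E : NTm Λ} {T : Ty K Empty}
    (h : NTyping Λ Γ E T) (L : List (Ground K)) (hL : L = Γ ++ T.args) :
    ∃ e : ATm Λ L.length, AbsTy.ground T.res ≤ e.infer id L.get ∧ e.size = E.size := by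
  induction h with
  | body Γ f T h =>
    have hlt : ∀ j : Fin T.args.length, Γ.length + j < L.length := fun j => by
      rw [hL, List.length_append]
      omega
    obtain ⟨e, he, hs⟩ := h.exists_etaLong (L := L) (fun i b hb => by
        rw [hL, List.getElem?_append_left (List.getElem?_eq_some_iff.1 hb).1, hb])
      -- The body may still have an arrow type; it is applied to the variables of the missing
      -- abstractions, which add nothing to the size.
      (List.ofFn fun j : Fin T.args.length => .var ⟨Γ.length + j, hlt j⟩)
      (List.forall₂_iff_get.2 ⟨by simp, fun i h₁ h₂ => by
        subst hL
        simp [ATm.infer]⟩)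
    exact ⟨e, he, by simpa [List.map_ofFn, List.sum_ofFn, ATm.size, NTm.size] using hs⟩
  | lam Γ E b T _ ih =>
    exact ih (by simp [hL, Ty.args])

/-- Every well-typed term has a well-typed `η`-long form of the same size. -/
theorem NTyping.exists_concreteCheck {E : NTm Λ} {t : Ty K Empty} (h : NTyping Λ [] E t) :
    ∃ e : Prog Λ t, ConcreteCheck t e ∧ e.size = E.size :=
  h.exists_etaLong t.args rfl

end Typing

/-! ### Refinement excludes spurious programs -/

section Refine

variable {K : TyCons} {Λ : Library K} {n : ℕ} {Γ : Fin n → Ground K} {t : Ty K Empty}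
  {𝒜 𝒜' : Set (AbsTy K)}

/-- Each step strictly raises a finite tuple in the product order, and generalization has no
infinite strict chains. -/
theorem WeakenStep.wellFounded (Λ : Library K) (c : Λ.Comp) (R : AbsTy K) :
    WellFounded fun Bs' Bs => WeakenStep Λ c R Bs Bs' := by
  refine Subrelation.wf (r := (· > ·)) ?_
    (wellFounded_lt (α := Fin (Λ.arity c) → (AbsTy K)ᵒᵈ))
  rintro Bs' Bs ⟨j, B', _, hlt, rfl, _⟩
  exact lt_update_self_iff.2 hlt

theorem ATm.label_concreteLabels (e : ATm Λ n) : (e.concreteLabels Γ).label = e.infer id Γ := by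
  cases e <;> rfl

theorem LTree.setLabel_label (U : LTree Λ n) : U.setLabel U.label = U := by
  cases U <;> rfl

theorem Generalize.refl (U : LTree Λ n) : Generalize U U := by
  induction U with
  | var B i => exact .var B i
  | app B c us ih =>
    refine .app B c us us _ .refl fun j => ?_
    rw [LTree.setLabel_label]
    exact ih j

theorem WeakenStep.reflTransGen {c : Λ.Comp} {R : AbsTy K} {Bs Bs' : Fin (Λ.arity c) → AbsTy K}
    (h : Relation.ReflTransGen (WeakenStep Λ c R) Bs Bs') (hR : Λ.sem c Bs ≤ R) :
    Bs ≤ Bs' ∧ Λ.sem c Bs' ≤ R := by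
  induction h with
  | refl => exact ⟨le_rfl, hR⟩
  | tail _ h ih =>
    obtain ⟨j, B', _, hlt, rfl, hsem⟩ := h
    exact ⟨ih.1.trans (le_update_self_iff.2 hlt.le), hsem⟩

/-- In a cover that contains all labels of a generalized tree, the type inferred for the term is
bounded by the label of the root. -/
theorem Generalize.infer_le (h𝒜 : IsCover 𝒜) (e : ATm Λ n) {R : AbsTy K} {U : LTree Λ n}
    (hU : Generalize ((e.concreteLabels Γ).setLabel R) U) (hR : e.infer id Γ ≤ R)
    (hmem : U.range ⊆ 𝒜) : e.infer (abstr 𝒜) Γ ≤ R := by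
  induction e generalizing R U with
  | var i =>
    cases hU
    exact h𝒜.abstr_le (hmem rfl) hR
  | app c es ih =>
    cases hU with
    | app _ _ _ us' Bs hBs hus =>
      have hlab : (fun j => ((es j).concreteLabels Γ).label) = fun j => (es j).infer id Γ :=
        funext fun j => (es j).label_concreteLabels
      rw [hlab] at hBs
      obtain ⟨hle, hsem⟩ := WeakenStep.reflTransGen hBs hR
      -- The root label `R` survives in the generalized tree and hence is in the cover, so
      -- abstraction cannot climb above it.
      refine h𝒜.abstr_le (hmem (Set.mem_insert _ _)) (le_trans (Library.sem_mono fun j => ?_) hsem)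
      exact ih j (hus j) (hle j)
        ((Set.subset_iUnion (fun j => (us' j).range) j).trans
          ((Set.subset_insert _ _).trans hmem))

theorem LTree.finite_range (U : LTree Λ n) : U.range.Finite := by
  induction U with
  | var B i => exact Set.finite_singleton B
  | app B c us ih => exact (Set.finite_iUnion ih).insert B

theorem IsCover.meetClosure (h𝒜 : IsCover 𝒜) {S : Set (AbsTy K)} (hS : S.Finite) :
    IsCover {A | MeetClosure (𝒜 ∪ S) A} where
  finite := MeetClosure.finite (h𝒜.finite.union hS)
  top_mem := .base _ (.inl h𝒜.top_mem)
  bot_mem := .base _ (.inl h𝒜.bot_mem)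
  meet_mem _ hA _ hB := .meet _ _ hA hB

theorem Refine.isCover {e : Prog Λ t} (h : Refine t 𝒜 e 𝒜') (h𝒜 : IsCover 𝒜) : IsCover 𝒜' := by
  obtain ⟨U, _, rfl⟩ := h
  exact h𝒜.meetClosure U.finite_range

theorem Refine.subset {e : Prog Λ t} (h : Refine t 𝒜 e 𝒜') : 𝒜 ⊆ 𝒜' := by
  obtain ⟨U, _, rfl⟩ := h
  exact fun A hA => .base _ (.inl hA)

theorem Refine.exists (𝒜 : Set (AbsTy K)) (e : Prog Λ t) : ∃ 𝒜', Refine t 𝒜 e 𝒜' :=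
  ⟨_, _, Generalize.refl _, rfl⟩

theorem ATm.infer_lift (α : AbsTy K → AbsTy K) (b : Ground K) (e : ATm Λ n) :
    (e.lift b).infer α Γ = e.infer α Γ := by
  induction e with
  | var i => rfl
  | app c es ih =>
    have h : (fun j => ((es j).lift b).infer α Γ) = fun j => (es j).infer α Γ := funext ih
    exact congrArg (fun f => α (Λ.sem c f)) h

/-- Its type being ground, `r` acts as a test: it yields `b` or `⊥` according to whether the check
against `b` succeeds. -/
theorem Library.of_le_sem_goal {b : Ground K} {A : AbsTy K} {B : Base K ℕ} :
    AbsTy.of B ≤ (Λ.addGoal b).sem none (fun _ => A) ↔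
      B = Base.ofGround b ∧ AbsTy.ground b ≤ A := by
  refine Library.of_le_sem.trans ⟨?_, ?_⟩
  · rintro ⟨σ, rfl, hσ⟩
    have := hσ (⟨0, Nat.one_pos⟩ : Fin 1)
    refine ⟨Base.ofGround_subst b σ, ?_⟩
    rwa [show ((Λ.addGoal b).ty none).args.get (⟨0, Nat.one_pos⟩ : Fin 1) = Base.ofGround b from rfl,
      Base.ofGround_subst] at this
  · rintro ⟨rfl, hA⟩
    refine ⟨Base.var, (Base.subst_var _).symm, fun i => ?_⟩
    rw [Base.subst_var]
    obtain ⟨i, hi⟩ := i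
    obtain rfl : i = 0 := Nat.lt_one_iff.1 hi
    exact hA

/-- Refinement excludes spurious programs. -/
theorem Refine.not_absCheck {e : Prog Λ t} (h : Refine t 𝒜 e 𝒜') (h𝒜 : IsCover 𝒜)
    (he : ¬ ConcreteCheck t e) : ¬ AbsCheck 𝒜' t e := by
  intro hA
  have h𝒜' := h.isCover h𝒜
  obtain ⟨U, hU, rfl⟩ := h
  have hbot : (e.star t.res).infer id t.args.get = AbsTy.bot K := by
    refine le_antisymm (AbsTy.le_iff.2 fun B hB => (he ?_).elim) (AbsTy.bot_le _)
    have := (Library.of_le_sem_goal.1 hB).2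
    rwa [ATm.infer_lift] at this
  rw [← LTree.setLabel_label ((e.star t.res).concreteLabels _), ATm.label_concreteLabels] at hU
  have hle := hU.infer_le h𝒜' _ le_rfl fun A hA => .base _ (.inr hA)
  rw [hbot] at hle
  refine AbsTy.not_ground_le_bot t.res (le_trans ?_ hle)
  -- If `e` passed the check, `b` would lie below the type inferred for `r e`, which is `⊥`.
  refine le_trans (Library.of_le_sem_goal.2 ⟨rfl, ?_⟩) (h𝒜'.le_abstr _)
  rw [ATm.infer_lift]
  exact hA

end Refine

/-! ### Symbolic execution and the token game -/

section Net

variable {K : TyCons} {Λ : Library K} {t : Ty K Empty} {𝒜 : Set (AbsTy K)} {n : ℕ}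

open Classical in
/-- The marking of a multiset of tokens. -/
noncomputable def Tokens.marking (S : Tokens Λ n) (p : AbsTy K) : ℕ := (S.map Prod.fst).count p

open Classical in
theorem count_map_univ {ι P : Type} [Fintype ι] (f : ι → P) (p : P) :
    (Finset.univ.val.map f).count p = (Finset.univ.filter fun j => f j = p).card := by
  rw [Multiset.count_map, Finset.card, Finset.filter_val]
  simp only [eq_comm]

theorem PetriNet.Fires.unique {P T : Type} {N : PetriNet P T} {M M₁ M₂ : P → ℕ} {x : T}
    (h₁ : N.Fires M x M₁) (h₂ : N.Fires M x M₂) : M₁ = M₂ :=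
  funext fun p => by rw [(h₁.2 p).2, (h₂.2 p).2]

theorem PetriNet.IsPath.unique {P T : Type} {N : PetriNet P T} {M M₁ M₂ : P → ℕ} {π : List T}
    (h₁ : N.IsPath M π M₁) (h₂ : N.IsPath M π M₂) : M₁ = M₂ := by
  induction h₁ with
  | nil M => cases h₂; rfl
  | cons M M' M₁ x π hx _ ih =>
    cases h₂ with
    | cons _ M'' _ _ _ hx' hπ' =>
      rw [hx.unique hx'] at ih
      exact ih hπ'

theorem PetriNet.IsPath.mem_transitions {P T : Type} {N : PetriNet P T} {M M' : P → ℕ}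
    {π : List T} (h : N.IsPath M π M') : ∀ x ∈ π, x ∈ N.transitions := by
  induction h with
  | nil M => simp
  | cons M M' M₁ x π hx _ ih => exact List.forall_mem_cons.2 ⟨hx.1, ih⟩

theorem map_univ_perm {ι P : Type} [Fintype ι] (s : Equiv.Perm ι) (f : ι → P) :
    Finset.univ.val.map (fun j => f (s j)) = Finset.univ.val.map f := by
  conv_rhs => rw [← Multiset.map_univ_val_equiv s, Multiset.map_map]
  rfl

/-- Symbolic execution follows the token game of the net. -/
theorem TokStep.fires {x : Transition Λ} {S S' : Tokens Λ n} (h : TokStep x S S')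
    (hx : x ∈ (atn Λ t 𝒜).transitions) : (atn Λ t 𝒜).Fires S.marking x S'.marking := by
  classical
  refine ⟨hx, fun p => ?_⟩
  cases h with
  | comp c As A s es R =>
    have h1 : Tokens.marking (Finset.univ.val.map (fun j => (As (s j), es j)) + R) p =
        (atn Λ t 𝒜).pre p (.comp c As A) + R.marking p := by
      simp only [Tokens.marking, Multiset.map_add, Multiset.count_add, Multiset.map_map]
      congr 1
      refine Eq.trans ?_ (count_map_univ As p)
      rw [← map_univ_perm s As]
      rfl
    have h2 : Tokens.marking ((A, ATm.app c es) ::ₘ R) p =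
        R.marking p + (atn Λ t 𝒜).post (.comp c As A) p := by
      simp only [Tokens.marking, Multiset.map_cons, Multiset.count_cons]
      rfl
    rw [h1, h2]
    omega
  | copy q e R =>
    simp only [Tokens.marking, Multiset.map_cons, Multiset.count_cons, atn]
    split_ifs <;> omega
  | delete q e R =>
    simp only [Tokens.marking, Multiset.map_cons, Multiset.count_cons, atn]
    split_ifs <;> omega

theorem TokRun.isPath {π : List (Transition Λ)} {S S' : Tokens Λ n} (h : TokRun S π S')
    (hπ : ∀ x ∈ π, x ∈ (atn Λ t 𝒜).transitions) :
    (atn Λ t 𝒜).IsPath S.marking π S'.marking := by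
  induction h with
  | nil S => exact .nil _
  | cons S₁ S₂ S₃ x π hx _ ih =>
    rw [List.forall_mem_cons] at hπ
    exact .cons _ _ _ _ _ (hx.fires hπ.1) (ih hπ.2)

theorem marking_initTokens : (initTokens Λ t 𝒜).marking = (atn Λ t 𝒜).init := by
  funext p
  simp only [Tokens.marking, initTokens, Multiset.map_map]
  exact count_map_univ _ p

/-- The end of the runs of a valid path. -/
theorem TransitionNet.ValidPath.mem_final {π : List (Transition Λ)}
    (hπ : (atn Λ t 𝒜).ValidPath π) {f : AbsTy K} {e : Prog Λ t}
    (h : TokRun (initTokens Λ t 𝒜) π {(f, e)}) : f ∈ (atn Λ t 𝒜).final := by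
  classical
  obtain ⟨M, hM, f', hf', h1, _⟩ := hπ
  -- A path determines its final marking, so the run must leave its only token where the valid path
  -- does.
  have hrun := h.isPath hM.mem_transitions
  rw [marking_initTokens] at hrun
  rw [hM.unique hrun] at h1
  by_cases hff : f' = f
  · exact hff ▸ hf'
  · simp [Tokens.marking, hff] at h1

theorem validPath_of_tokRun {π : List (Transition Λ)}
    (hπ : ∀ x ∈ π, x ∈ (atn Λ t 𝒜).transitions) {f : AbsTy K} {e : Prog Λ t}
    (h : TokRun (initTokens Λ t 𝒜) π {(f, e)}) (hf : f ∈ (atn Λ t 𝒜).final) :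
    (atn Λ t 𝒜).ValidPath π := by
  classical
  refine ⟨_, marking_initTokens ▸ h.isPath hπ, f, hf, ?_, fun p _ hp => ?_⟩
  · simp [Tokens.marking]
  · simp [Tokens.marking, hp]

/-! ## From valid paths to abstractly well-typed programs -/

/-- Every token carries a term with the type of its place. -/
def Tokens.WellTyped (𝒜 : Set (AbsTy K)) (t : Ty K Empty) (S : Tokens Λ t.args.length) : Prop :=
  ∀ a ∈ S, a.2.infer (abstr 𝒜) t.args.get = a.1 ∧ a.1 ∈ (atn Λ t 𝒜).places

theorem IsCover.abstr_ground_mem_places (h𝒜 : IsCover 𝒜) (b : Ground K) :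
    abstr 𝒜 (.ground b) ∈ (atn Λ t 𝒜).places :=
  ⟨h𝒜.abstr_mem _, fun h => AbsTy.not_ground_le_bot b ((h𝒜.le_abstr _).trans_eq h)⟩

theorem IsCover.wellTyped_initTokens (h𝒜 : IsCover 𝒜) :
    (initTokens Λ t 𝒜).WellTyped 𝒜 t := by
  intro a ha
  obtain ⟨i, _, rfl⟩ := Multiset.mem_map.1 ha
  exact ⟨rfl, h𝒜.abstr_ground_mem_places _⟩

open Classical in
theorem exists_tokens_of_le {P T ι : Type} [Nonempty T] (As : ι → P) (s : Finset ι)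
    (S : Multiset (P × T)) (h : s.val.map As ≤ S.map Prod.fst) :
    ∃ (es : ι → T) (R : Multiset (P × T)), S = s.val.map (fun j => (As j, es j)) + R := by
  induction s using Finset.induction_on generalizing S with
  | empty => exact ⟨fun _ => Classical.arbitrary T, S, by simp⟩
  | insert j s hj ih =>
    rw [Finset.insert_val_of_notMem hj, Multiset.map_cons] at h
    obtain ⟨a, ha, haj⟩ := Multiset.mem_map.1 (Multiset.mem_of_le h (Multiset.mem_cons_self _ _))
    obtain ⟨S, rfl⟩ := Multiset.exists_cons_of_mem ha
    rw [Multiset.map_cons, haj, Multiset.cons_le_cons_iff] at h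
    obtain ⟨es, R, rfl⟩ := ih S h
    refine ⟨Function.update es j a.2, R, ?_⟩
    rw [Finset.insert_val_of_notMem hj, Multiset.map_cons, Multiset.cons_add]
    congr 1
    · simp [← haj]
    · congr 1
      refine Multiset.map_congr rfl fun i hi => ?_
      rw [Function.update_of_ne]
      rintro rfl
      exact hj hi

theorem exists_token_of_pos {S : Tokens Λ n} {p : AbsTy K} (h : 1 ≤ S.marking p) :
    ∃ e R, S = (p, e) ::ₘ R := by
  classical
  obtain ⟨a, ha, rfl⟩ := Multiset.mem_map.1 (Multiset.one_le_count_iff_mem.1 h)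
  obtain ⟨R, rfl⟩ := Multiset.exists_cons_of_mem ha
  exact ⟨a.2, R, rfl⟩

/-- Enabledness supplies enough tokens in the right places. Passing their terms in the order of the
input places keeps the tokens well-typed. -/
theorem PetriNet.Fires.exists_tokStep {S : Tokens Λ t.args.length} {x : Transition Λ}
    {M : AbsTy K → ℕ} (h : (atn Λ t 𝒜).Fires S.marking x M) (hS : S.WellTyped 𝒜 t) :
    ∃ S', TokStep x S S' ∧ S'.WellTyped 𝒜 t ∧ S'.marking = M := by
  classical
  suffices ∃ S', TokStep x S S' ∧ S'.WellTyped 𝒜 t by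
    obtain ⟨S', h1, h2⟩ := this
    exact ⟨S', h1, h2, (h1.fires h.1).unique h⟩
  have hx := h.1
  cases x with
  | comp c As A =>
    obtain ⟨hAs, hA, hsem⟩ := hx
    have hle : Finset.univ.val.map As ≤ S.map Prod.fst := Multiset.le_iff_count.2 fun p => by
      rw [count_map_univ]
      exact (h.2 p).1
    -- Choosing a term for each index needs an inhabitant. Without programs there are no tokens, so
    -- `c` has no inputs; but then `c` itself is a program.
    by_cases hne : Nonempty (Prog Λ t)
    · obtain ⟨es, R, rfl⟩ := exists_tokens_of_le As Finset.univ S hle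
      refine ⟨_, .comp c As A 1 es R, fun a ha => ?_⟩
      rcases Multiset.mem_cons.1 ha with rfl | ha
      · refine ⟨?_, hA⟩
        have : (fun j => (es j).infer (abstr 𝒜) t.args.get) = As := funext fun j =>
          (hS (As j, es j) (Multiset.mem_add.2 (.inl (Multiset.mem_map.2
            ⟨j, Finset.mem_univ_val j, rfl⟩)))).1
        simp only [ATm.infer, this, hsem]
      · exact hS a (Multiset.mem_add.2 (.inr ha))
    · have : IsEmpty (Fin (Λ.arity c)) := ⟨fun j => by
        obtain ⟨a, _, _⟩ := Multiset.mem_map.1 (Multiset.mem_of_le hle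
          (Multiset.mem_map_of_mem As (Finset.mem_univ_val j)))
        exact hne ⟨a.2⟩⟩
      exact (hne ⟨.app c fun j => isEmptyElim j⟩).elim
  | copy p =>
    have h1 : 1 ≤ S.marking p := (if_pos rfl).symm.trans_le (h.2 p).1
    obtain ⟨e, R, rfl⟩ := exists_token_of_pos h1
    refine ⟨_, .copy p e R, fun a ha => hS a ?_⟩
    rcases Multiset.mem_cons.1 ha with rfl | ha
    · exact Multiset.mem_cons_self _ _
    · exact ha
  | delete p =>
    have h1 : 1 ≤ S.marking p := (if_pos rfl).symm.trans_le (h.2 p).1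
    obtain ⟨e, R, rfl⟩ := exists_token_of_pos h1
    exact ⟨_, .delete p e R, fun a ha => hS a (Multiset.mem_cons_of_mem ha)⟩

theorem PetriNet.IsPath.exists_tokRun {π : List (Transition Λ)} {M M' : AbsTy K → ℕ}
    (h : (atn Λ t 𝒜).IsPath M π M') {S : Tokens Λ t.args.length} (hM : S.marking = M)
    (hS : S.WellTyped 𝒜 t) :
    ∃ S', TokRun S π S' ∧ S'.WellTyped 𝒜 t ∧ S'.marking = M' := by
  induction h generalizing S with
  | nil M => exact ⟨S, .nil S, hS, hM⟩
  | cons M₁ M₂ M₃ x π hx _ ih =>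
    subst hM
    obtain ⟨S₂, h1, h2, h3⟩ := hx.exists_tokStep hS
    obtain ⟨S₃, h4, h5⟩ := ih h3 h2
    exact ⟨S₃, .cons _ _ _ _ _ h1 h4, h5⟩

/-- Every valid path yields an abstractly well-typed program. -/
theorem TransitionNet.ValidPath.exists_absCheck (h𝒜 : IsCover 𝒜) {π : List (Transition Λ)}
    (h : (atn Λ t 𝒜).ValidPath π) : ∃ e ∈ fromPath Λ t 𝒜 π, AbsCheck 𝒜 t e := by
  classical
  obtain ⟨M, hM, f, hf, h1, h0⟩ := h
  obtain ⟨S, hrun, hS, rfl⟩ := hM.exists_tokRun marking_initTokens h𝒜.wellTyped_initTokens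
  have hmap : S.map Prod.fst = {f} := by
    ext p
    rw [Multiset.count_singleton]
    split_ifs with hp
    · exact hp ▸ h1
    -- Validity restricts the final marking only at places of the net; elsewhere well-typedness
    -- rules out tokens.
    · by_cases hpl : p ∈ (atn Λ t 𝒜).places
      · exact h0 p hpl hp
      · refine Multiset.count_eq_zero.2 fun hmem => hpl ?_
        obtain ⟨a, ha, rfl⟩ := Multiset.mem_map.1 hmem
        exact (hS a ha).2
  obtain ⟨⟨f', e⟩, rfl⟩ := Multiset.card_eq_one.1 (by
    rw [← Multiset.card_map Prod.fst S, hmap, Multiset.card_singleton])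
  obtain rfl : f' = f := by simpa using hmap
  refine ⟨e, ⟨f', hrun⟩, ?_⟩
  rw [AbsCheck, Check, (hS _ (Multiset.mem_singleton_self _)).1]
  exact hf.2

/-! ## From abstractly well-typed programs to valid paths -/

theorem TokRun.append {π π' : List (Transition Λ)} {S₁ S₂ S₃ : Tokens Λ n}
    (h : TokRun S₁ π S₂) (h' : TokRun S₂ π' S₃) : TokRun S₁ (π ++ π') S₃ := by
  induction h with
  | nil S => exact h'
  | cons S₁ S₂ S₃ x π hx _ ih => exact .cons _ _ _ _ _ hx (ih h')

/-- The variable occurrences of a term. -/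
def ATm.occs : ATm Λ n → Multiset (Fin n)
  | .var i => {i}
  | .app _ es => ∑ j, (es j).occs

/-- The initial token of a variable. -/
noncomputable def varToken (Λ : Library K) (t : Ty K Empty) (𝒜 : Set (AbsTy K))
    (i : Fin t.args.length) : AbsTy K × Prog Λ t :=
  (abstr 𝒜 (.ground (t.args.get i)), .var i)

/-- The net has a run from `S` to `S'` with at most `l` transitions, `k` of which are component
transitions. -/
def HasRun (t : Ty K Empty) (𝒜 : Set (AbsTy K)) (S S' : Tokens Λ t.args.length) (l k : ℕ) : Prop :=
  ∃ π, (∀ x ∈ π, x ∈ (atn Λ t 𝒜).transitions) ∧ TokRun S π S' ∧ π.length ≤ l ∧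
    (π.map Transition.weight).sum = k

theorem HasRun.refl (S : Tokens Λ t.args.length) : HasRun t 𝒜 S S 0 0 :=
  ⟨[], by simp, .nil S, le_rfl, rfl⟩

theorem HasRun.trans {S₁ S₂ S₃ : Tokens Λ t.args.length} {l k l' k' : ℕ}
    (h : HasRun t 𝒜 S₁ S₂ l k) (h' : HasRun t 𝒜 S₂ S₃ l' k') :
    HasRun t 𝒜 S₁ S₃ (l + l') (k + k') := by
  obtain ⟨π, h1, h2, h3, h4⟩ := h
  obtain ⟨π', h1', h2', h3', h4'⟩ := h'
  refine ⟨π ++ π', fun x hx => (List.mem_append.1 hx).elim (h1 x) (h1' x), h2.append h2', ?_, ?_⟩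
  · rw [List.length_append]
    exact Nat.add_le_add h3 h3'
  · rw [List.map_append, List.sum_append, h4, h4']

theorem HasRun.single {S S' : Tokens Λ t.args.length} {x : Transition Λ}
    (hx : x ∈ (atn Λ t 𝒜).transitions) (h : TokStep x S S') : HasRun t 𝒜 S S' 1 x.weight :=
  ⟨[x], by simpa using hx, .cons _ _ _ _ _ h (.nil _), le_rfl, by simp⟩

/-- Parallel composition of runs. -/
theorem HasRun.sum {ι : Type} (s : Finset ι) {F G : ι → Tokens Λ t.args.length} {l k : ι → ℕ}
    (h : ∀ i ∈ s, ∀ R, HasRun t 𝒜 (F i + R) (G i + R) (l i) (k i)) (R : Tokens Λ t.args.length) :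
    HasRun t 𝒜 (∑ i ∈ s, F i + R) (∑ i ∈ s, G i + R) (∑ i ∈ s, l i) (∑ i ∈ s, k i) := by
  classical
  induction s using Finset.induction_on generalizing R with
  | empty => simpa using HasRun.refl R
  | insert j s hj ih =>
    simp only [Finset.sum_insert hj]
    have h1 := h j (Finset.mem_insert_self j s) (∑ i ∈ s, F i + R)
    have h2 := ih (fun i hi => h i (Finset.mem_insert_of_mem hi)) (G j + R)
    rw [add_left_comm (∑ i ∈ s, G i)] at h2
    rw [add_left_comm (G j)] at h1
    rw [add_assoc (F j), add_assoc (G j)]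
    exact h1.trans h2

theorem varToken_mem_transitions (h𝒜 : IsCover 𝒜) (i : Fin t.args.length) :
    (varToken Λ t 𝒜 i).1 ∈ (atn Λ t 𝒜).places ∧ 0 < (atn Λ t 𝒜).init (varToken Λ t 𝒜 i).1 := by
  classical
  refine ⟨h𝒜.abstr_ground_mem_places _, ?_⟩
  rw [← marking_initTokens]
  refine Multiset.count_pos.2 (Multiset.mem_map.2 ⟨varToken Λ t 𝒜 i, ?_, rfl⟩)
  exact Multiset.mem_map.2 ⟨i, Finset.mem_univ_val i, rfl⟩

/-- No occurrence takes one deletion, one takes nothing, and more take `k - 1` copies; `k + 1`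
covers all cases. -/
theorem hasRun_copy (h𝒜 : IsCover 𝒜) (i : Fin t.args.length) (k : ℕ)
    (R : Tokens Λ t.args.length) :
    HasRun t 𝒜 ({varToken Λ t 𝒜 i} + R) (Multiset.replicate k (varToken Λ t 𝒜 i) + R)
      (k + 1) 0 := by
  cases k with
  | zero =>
    rw [Multiset.replicate_zero, zero_add, Multiset.singleton_add]
    exact .single (varToken_mem_transitions (Λ := Λ) h𝒜 i) (.delete _ _ R)
  | succ k =>
    induction k generalizing R with
    | zero =>
      obtain ⟨π, h1, h2, h3, h4⟩ := HasRun.refl (𝒜 := 𝒜) ({varToken Λ t 𝒜 i} + R)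
      exact ⟨π, h1, by simpa using h2, by omega, h4⟩
    | succ k ih =>
      have h1 : HasRun t 𝒜 ({varToken Λ t 𝒜 i} + R)
          ({varToken Λ t 𝒜 i} + ({varToken Λ t 𝒜 i} + R)) 1 0 :=
        .single (x := .copy _) (varToken_mem_transitions (Λ := Λ) h𝒜 i) (.copy _ _ R)
      have h2 := h1.trans (ih ({varToken Λ t 𝒜 i} + R))
      rw [← add_assoc (Multiset.replicate _ _), ← Multiset.replicate_one, ← Multiset.replicate_add,
        add_comm 1] at h2
      exact h2

/-- The leaves are consumed exactly once, bottom-up. Transformers and abstraction preserve `⊥`, so a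
root type other than `⊥` puts the types of all subterms among the places. -/
theorem hasRun_build (h𝒜 : IsCover 𝒜) (e : Prog Λ t)
    (he : e.infer (abstr 𝒜) t.args.get ≠ AbsTy.bot K) (R : Tokens Λ t.args.length) :
    HasRun t 𝒜 (e.occs.map (varToken Λ t 𝒜) + R)
      ({(e.infer (abstr 𝒜) t.args.get, e)} + R) e.size e.size := by
  induction e generalizing R with
  | var i => exact .refl _
  | app c es ih =>
    have hne : ∀ j, (es j).infer (abstr 𝒜) t.args.get ≠ AbsTy.bot K := fun j hj => he (by
      rw [ATm.infer, Library.sem_eq_bot (i := j) hj, h𝒜.abstr_bot])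
    have h1 := HasRun.sum Finset.univ (fun j _ R => ih j (hne j) R) R
    have hmap : (∑ j, (es j).occs).map (varToken Λ t 𝒜) =
        ∑ j, (es j).occs.map (varToken Λ t 𝒜) :=
      map_sum (Multiset.mapAddMonoidHom (varToken Λ t 𝒜)) _ _
    have hsum : ∑ j, {((es j).infer (abstr 𝒜) t.args.get, es j)} =
        Finset.univ.val.map fun j => ((es j).infer (abstr 𝒜) t.args.get, es j) := by
      rw [← Multiset.sum_map_singleton (Finset.univ.val.map _), Multiset.map_map]
      rfl
    rw [hsum, ← hmap] at h1
    rw [ATm.occs, ATm.size, add_comm 1]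
    refine h1.trans (.single (x := .comp c _ _) ⟨fun j => ⟨(es j).infer_abstr_mem h𝒜, hne j⟩,
      ⟨ATm.infer_abstr_mem h𝒜 _, he⟩, rfl⟩ (.comp c _ _ 1 es R))

theorem sum_replicate_count [DecidableEq (Fin n)] (O : Multiset (Fin n)) :
    ∑ i, Multiset.replicate (O.count i) i = O := by
  ext i
  simp [Multiset.count_sum', Multiset.count_replicate]

/-- All copying and deleting can be done on the variables in advance, where these transitions are
available. -/
theorem hasRun_vars (h𝒜 : IsCover 𝒜) (O : Multiset (Fin t.args.length)) :
    HasRun t 𝒜 (initTokens Λ t 𝒜) (O.map (varToken Λ t 𝒜))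
      (Multiset.card O + t.args.length) 0 := by
  have h := HasRun.sum Finset.univ (fun i _ R => hasRun_copy (Λ := Λ) h𝒜 i (O.count i) R) 0
  have h1 : ∑ i, {varToken Λ t 𝒜 i} = initTokens Λ t 𝒜 := by
    rw [← Multiset.sum_map_singleton (initTokens Λ t 𝒜), initTokens, Multiset.map_map]
    rfl
  have h2 : ∑ i, Multiset.replicate (O.count i) (varToken Λ t 𝒜 i) = O.map (varToken Λ t 𝒜) := by
    conv_rhs => rw [← sum_replicate_count O]
    refine Eq.trans ?_ (map_sum (Multiset.mapAddMonoidHom (varToken Λ t 𝒜)) _ _).symm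
    simp
  have h3 : ∑ i, (O.count i + 1) = Multiset.card O + t.args.length := by
    rw [Finset.sum_add_distrib, Multiset.sum_count_eq_card (by simp)]
    simp
  rw [h1, h2, h3, add_zero, add_zero, Finset.sum_const_zero] at h
  exact h

/-- Every abstractly well-typed program is yielded by a valid path, the length of which is bounded
independently of the cover. -/
theorem AbsCheck.exists_validPath (h𝒜 : IsCover 𝒜) {e : Prog Λ t} (he : AbsCheck 𝒜 t e) :
    ∃ π, (atn Λ t 𝒜).ValidPath π ∧ e ∈ fromPath Λ t 𝒜 π ∧
      π.length ≤ Multiset.card e.occs + t.args.length + e.size ∧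
      (π.map Transition.weight).sum = e.size := by
  have hne : e.infer (abstr 𝒜) t.args.get ≠ AbsTy.bot K := fun h =>
    AbsTy.not_ground_le_bot t.res (h ▸ he)
  have h := hasRun_build h𝒜 e hne 0
  rw [add_zero, add_zero] at h
  obtain ⟨π, h1, h2, h3, h4⟩ := (hasRun_vars h𝒜 e.occs).trans h
  exact ⟨π, validPath_of_tokRun h1 h2 ⟨⟨e.infer_abstr_mem h𝒜, hne⟩, he⟩, ⟨_, h2⟩, h3,
    h4.trans (zero_add _)⟩

/-! ## Finiteness -/

theorem finite_terms (S : Tokens Λ n) : {e | ∃ p, (p, e) ∈ S}.Finite := by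
  classical
  refine ((S.toFinset.finite_toSet).image Prod.snd).subset ?_
  rintro e ⟨p, hp⟩
  exact ⟨(p, e), by simpa using hp, rfl⟩

/-- A step is determined by the consumed terms and, for a component, the permutation; the remaining
tokens follow by subtraction. -/
theorem TokStep.finite (x : Transition Λ) (S : Tokens Λ n) : {S' | TokStep x S S'}.Finite := by
  classical
  cases x with
  | comp c As A =>
    refine (((Set.finite_univ (α := Equiv.Perm (Fin (Λ.arity c)))).prod
      (Set.Finite.pi' fun _ : Fin (Λ.arity c) => finite_terms S)).image fun a =>
        (A, ATm.app c a.2) ::ₘ (S - Finset.univ.val.map fun j => (As (a.1 j), a.2 j))).subset ?_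
    intro S' h
    cases h with
    | comp _ _ _ s es R =>
      refine ⟨(s, es), ⟨Set.mem_univ _, fun j => ⟨As (s j), ?_⟩⟩, ?_⟩
      · exact Multiset.mem_add.2 (.inl (Multiset.mem_map.2 ⟨j, Finset.mem_univ_val j, rfl⟩))
      · simp
  | copy p =>
    refine ((finite_terms S).image fun e => (p, e) ::ₘ S).subset ?_
    intro S' h
    cases h with
    | copy _ e R => exact ⟨e, ⟨p, Multiset.mem_cons_self _ _⟩, rfl⟩
  | delete p =>
    refine ((finite_terms S).image fun e => S.erase (p, e)).subset ?_
    intro S' h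
    cases h with
    | delete _ e R => exact ⟨e, ⟨p, Multiset.mem_cons_self _ _⟩, Multiset.erase_cons_head _ _⟩

theorem TokRun.finite (π : List (Transition Λ)) (S : Tokens Λ n) : {S' | TokRun S π S'}.Finite := by
  induction π generalizing S with
  | nil =>
    refine (Set.finite_singleton S).subset ?_
    intro S' h
    cases h
    rfl
  | cons x π ih =>
    refine ((TokStep.finite x S).biUnion fun S' _ => ih S').subset ?_
    intro S' h
    cases h with
    | cons _ S₂ _ _ _ hx hπ => exact Set.mem_biUnion hx hπ

theorem finite_fromPath (π : List (Transition Λ)) : (fromPath Λ t 𝒜 π).Finite := by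
  refine ((TokRun.finite π (initTokens Λ t 𝒜)).biUnion fun S _ => finite_terms S).subset ?_
  rintro e ⟨f, h⟩
  exact Set.mem_biUnion h ⟨f, Multiset.mem_singleton_self _⟩

theorem ATm.finite_size_le (Λ : Library K) (n N : ℕ) : {e : ATm Λ n | e.size ≤ N}.Finite := by
  have := Λ.finite
  induction N with
  | zero =>
    refine (Set.finite_range (ATm.var (Λ := Λ) (n := n))).subset ?_
    intro e he
    cases e with
    | var i => exact ⟨i, rfl⟩
    | app c es => simp [ATm.size] at he
  | succ N ih =>
    refine ((Set.finite_range (ATm.var (Λ := Λ) (n := n))).union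
      (Set.finite_iUnion fun c : Λ.Comp => (Set.Finite.pi' fun _ : Fin (Λ.arity c) => ih).image
        (ATm.app c))).subset ?_
    intro e he
    cases e with
    | var i => exact .inl ⟨i, rfl⟩
    | app c es =>
      refine .inr (Set.mem_iUnion.2 ⟨c, es, fun j => ?_, rfl⟩)
      have h1 : (es j).size ≤ ∑ j, (es j).size :=
        Finset.single_le_sum (f := fun j => (es j).size) (fun _ _ => Nat.zero_le _)
          (Finset.mem_univ j)
      have h2 : 1 + ∑ j, (es j).size ≤ N + 1 := he
      change (es j).size ≤ N
      omega

end Net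

/-! ### Sizes of the programs of shortest paths -/

section Size

variable {K : TyCons} {Λ : Library K} {t : Ty K Empty} {𝒜 : Set (AbsTy K)} {n : ℕ}

/-- The least size of a term for which the type `p` is inferred. -/
noncomputable def minSize (Λ : Library K) (t : Ty K Empty) (𝒜 : Set (AbsTy K)) (p : AbsTy K) : ℕ :=
  sInf {k | ∃ u : Prog Λ t, u.infer (abstr 𝒜) t.args.get = p ∧ u.size = k}

theorem minSize_le (u : Prog Λ t) : minSize Λ t 𝒜 (u.infer (abstr 𝒜) t.args.get) ≤ u.size :=
  Nat.sInf_le ⟨u, rfl, rfl⟩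

theorem exists_size_eq_minSize {p : AbsTy K} (h : ∃ u : Prog Λ t, u.infer (abstr 𝒜) t.args.get = p) :
    ∃ u : Prog Λ t, u.infer (abstr 𝒜) t.args.get = p ∧ u.size = minSize Λ t 𝒜 p :=
  Nat.sInf_mem (s := {k | ∃ u : Prog Λ t, u.infer (abstr 𝒜) t.args.get = p ∧ u.size = k})
    (h.elim fun u hu => ⟨_, u, hu, rfl⟩)

/-- The places of all tokens are inhabited. -/
def Tokens.Inhabited (𝒜 : Set (AbsTy K)) (S : Tokens Λ t.args.length) : Prop :=
  ∀ a ∈ S, ∃ u : Prog Λ t, u.infer (abstr 𝒜) t.args.get = a.1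

/-- All tokens carry terms of the least size for their place. -/
def Tokens.Minimal (𝒜 : Set (AbsTy K)) (S : Tokens Λ t.args.length) : Prop :=
  ∀ a ∈ S, a.2.size = minSize Λ t 𝒜 a.1

/-- The total least size of the places of all tokens. -/
noncomputable def Tokens.potential (𝒜 : Set (AbsTy K)) (S : Tokens Λ t.args.length) : ℕ :=
  (S.map fun a => minSize Λ t 𝒜 a.1).sum

/-- A variable inhabits every initially marked place, so copying there is free for the potential,
even if the copied token carries a large term. -/
theorem minSize_eq_zero_of_init_pos {p : AbsTy K} (h : 0 < (atn Λ t 𝒜).init p) :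
    minSize Λ t 𝒜 p = 0 := by
  classical
  rw [← marking_initTokens] at h
  obtain ⟨a, ha, rfl⟩ := Multiset.mem_map.1 (Multiset.count_pos.1 h)
  obtain ⟨i, _, rfl⟩ := Multiset.mem_map.1 ha
  exact Nat.le_zero.1 (minSize_le (.var i : Prog Λ t))

/-- Applying `c` to least terms of the input places inhabits the output place, so a component
transition raises the potential by at most one. Without slack, least terms are turned into a least
term. Only places are tracked, so terms that are ill-typed after a permutation do no harm. -/
theorem TokStep.potential_le {x : Transition Λ} {S S' : Tokens Λ t.args.length}
    (h : TokStep x S S') (hx : x ∈ (atn Λ t 𝒜).transitions) (hS : S.Inhabited 𝒜) :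
    S'.Inhabited 𝒜 ∧ S'.potential 𝒜 ≤ S.potential 𝒜 + x.weight ∧
      (S.potential 𝒜 + x.weight ≤ S'.potential 𝒜 → S.Minimal 𝒜 → S'.Minimal 𝒜) := by
  cases h with
  | comp c As A s es R =>
    have hmem : ∀ j, (As (s j), es j) ∈
        Finset.univ.val.map (fun j => (As (s j), es j)) + R := fun j =>
      Multiset.mem_add.2 (.inl (Multiset.mem_map.2 ⟨j, Finset.mem_univ_val j, rfl⟩))
    have hAs : ∀ j, ∃ u : Prog Λ t, u.infer (abstr 𝒜) t.args.get = As j := fun j => by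
      simpa using hS _ (hmem (s.symm j))
    choose us hus hsize using fun j => exists_size_eq_minSize (hAs j)
    have hA : (ATm.app c us : Prog Λ t).infer (abstr 𝒜) t.args.get = A := by
      rw [ATm.infer, funext hus]
      exact hx.2.2
    have hle : minSize Λ t 𝒜 A ≤ 1 + ∑ j, minSize Λ t 𝒜 (As j) := by
      rw [← hA, ← funext hsize]
      exact minSize_le _
    have hpot : Tokens.potential 𝒜 (Finset.univ.val.map (fun j => (As (s j), es j)) + R) =
        ∑ j, minSize Λ t 𝒜 (As j) + R.potential 𝒜 := by
      simp only [Tokens.potential, Multiset.map_add, Multiset.sum_add, Multiset.map_map]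
      congr 1
      exact Equiv.sum_comp s fun j => minSize Λ t 𝒜 (As j)
    have hpot' : Tokens.potential 𝒜 ((A, (ATm.app c es : Prog Λ t)) ::ₘ R) =
        minSize Λ t 𝒜 A + R.potential 𝒜 := by
      simp [Tokens.potential]
    rw [hpot, hpot', Transition.weight]
    refine ⟨fun a ha => ?_, by omega, fun heq hmin a ha => ?_⟩
    · rcases Multiset.mem_cons.1 ha with rfl | ha
      · exact ⟨_, hA⟩
      · exact hS a (Multiset.mem_add.2 (.inr ha))
    · rcases Multiset.mem_cons.1 ha with rfl | ha
      · have h1 : ∑ j, (es j).size = ∑ j, minSize Λ t 𝒜 (As j) := by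
          rw [← Equiv.sum_comp s fun j => minSize Λ t 𝒜 (As j)]
          exact Finset.sum_congr rfl fun j _ => hmin _ (hmem j)
        simp only [ATm.size]
        omega
      · exact hmin a (Multiset.mem_add.2 (.inr ha))
  | copy p e R =>
    have h0 := minSize_eq_zero_of_init_pos (Λ := Λ) hx.2
    refine ⟨fun a ha => hS a ?_, by simp [Tokens.potential, h0], fun _ hmin a ha => hmin a ?_⟩ <;>
    · rcases Multiset.mem_cons.1 ha with rfl | ha
      · exact Multiset.mem_cons_self _ _
      · exact ha
  | delete p e R =>
    exact ⟨fun a ha => hS a (Multiset.mem_cons_of_mem ha), by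
      simp only [Tokens.potential, Multiset.map_cons, Multiset.sum_cons]
      omega,
      fun _ hmin a ha => hmin a (Multiset.mem_cons_of_mem ha)⟩

theorem TokRun.potential_le {π : List (Transition Λ)} {S S' : Tokens Λ t.args.length}
    (h : TokRun S π S') (hπ : ∀ x ∈ π, x ∈ (atn Λ t 𝒜).transitions) (hS : S.Inhabited 𝒜) :
    S'.Inhabited 𝒜 ∧ S'.potential 𝒜 ≤ S.potential 𝒜 + (π.map Transition.weight).sum ∧
      (S.potential 𝒜 + (π.map Transition.weight).sum ≤ S'.potential 𝒜 →
        S.Minimal 𝒜 → S'.Minimal 𝒜) := by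
  induction h with
  | nil S => exact ⟨hS, by simp, fun _ h => h⟩
  | cons S₁ S₂ S₃ x π hx _ ih =>
    rw [List.forall_mem_cons] at hπ
    obtain ⟨h1, h2, h3⟩ := hx.potential_le hπ.1 hS
    obtain ⟨h4, h5, h6⟩ := ih hπ.2 h1
    rw [List.map_cons, List.sum_cons]
    exact ⟨h4, by omega, fun heq hmin => h6 (by omega) (h3 (by omega) hmin)⟩

/-- All programs of a path with the least number of component transitions have this size. -/
theorem IsShortestValidPath.size_eq (h𝒜 : IsCover 𝒜) {π : List (Transition Λ)}
    (h : IsShortestValidPath .components Λ t 𝒜 π) {e : Prog Λ t} (he : e ∈ fromPath Λ t 𝒜 π) :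
    e.size = pathLength .components π := by
  obtain ⟨f, hrun⟩ := he
  have hf := h.1.mem_final hrun
  have hπ : ∀ x ∈ π, x ∈ (atn Λ t 𝒜).transitions := by
    obtain ⟨M, hM, _⟩ := h.1
    exact hM.mem_transitions
  have hinit : ∀ a ∈ initTokens Λ t 𝒜, ∃ i, a = varToken Λ t 𝒜 i := fun a ha => by
    obtain ⟨i, _, rfl⟩ := Multiset.mem_map.1 ha
    exact ⟨i, rfl⟩
  have hzero : ∀ a ∈ initTokens Λ t 𝒜, minSize Λ t 𝒜 a.1 = 0 := fun a ha => by
    obtain ⟨i, rfl⟩ := hinit a ha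
    exact Nat.le_zero.1 (minSize_le (.var i : Prog Λ t))
  obtain ⟨h1, h2, h3⟩ := hrun.potential_le hπ fun a ha => by
    obtain ⟨i, rfl⟩ := hinit a ha
    exact ⟨.var i, rfl⟩
  have hpot : (initTokens Λ t 𝒜).potential 𝒜 = 0 :=
    Multiset.sum_eq_zero fun k hk => by
      obtain ⟨a, ha, rfl⟩ := Multiset.mem_map.1 hk
      exact hzero a ha
  -- A least term `u` of the final place is abstractly well-typed and has a valid path with `u.size`
  -- component transitions. So the shortest path has at most that many, while `h2` gives at least
  -- that many; no step has slack.
  obtain ⟨u, rfl, hu⟩ := exists_size_eq_minSize (h1 _ (Multiset.mem_singleton_self _))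
  have huA : AbsCheck 𝒜 t u := hf.2
  obtain ⟨π', hπ', _, _, hw⟩ := huA.exists_validPath h𝒜
  have hle := h.2 π' hπ'
  simp only [pathLength, hw, hu] at hle
  have hpot' : Tokens.potential 𝒜 {(u.infer (abstr 𝒜) t.args.get, e)} =
      minSize Λ t 𝒜 (u.infer (abstr 𝒜) t.args.get) := by
    simp [Tokens.potential]
  rw [hpot, hpot'] at h2 h3
  have h4 := h3 (by omega) (fun a ha => by
    rw [hzero a ha]
    obtain ⟨i, rfl⟩ := hinit a ha
    rfl) _ (Multiset.mem_singleton_self _)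
  simp only [pathLength]
  simp only at h4
  omega

/-- A bound for the size of the terms after a transition. -/
def growth (a s : ℕ) : ℕ := 1 + (a + 1) * s

theorem growth_mono (a : ℕ) : Monotone (growth a) := fun _ _ h =>
  Nat.add_le_add_left (Nat.mul_le_mul_left _ h) _

theorem TokStep.size_le {a : ℕ} (ha : ∀ c, Λ.arity c ≤ a) {x : Transition Λ} {S S' : Tokens Λ n}
    (h : TokStep x S S') {s : ℕ} (hS : ∀ b ∈ S, b.2.size ≤ s) :
    ∀ b ∈ S', b.2.size ≤ growth a s := by
  -- The factor `a + 1` instead of `a` makes the bound hold for untouched tokens even when all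
  -- components are nullary.
  have hs : s ≤ growth a s := by
    rw [growth, Nat.add_mul]
    omega
  cases h with
  | comp c As A σ es R =>
    intro b hb
    rcases Multiset.mem_cons.1 hb with rfl | hb
    · have h1 : ∑ j, (es j).size ≤ Λ.arity c * s := by
        refine (Finset.sum_le_card_nsmul Finset.univ _ s fun j _ => hS (As (σ j), es j) ?_).trans ?_
        · exact Multiset.mem_add.2 (.inl (Multiset.mem_map.2 ⟨j, Finset.mem_univ_val j, rfl⟩))
        · simp
      have h2 : Λ.arity c * s ≤ (a + 1) * s := Nat.mul_le_mul_right _ ((ha c).trans (Nat.le_succ a))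
      simp only [ATm.size, growth]
      omega
    · exact (hS b (Multiset.mem_add.2 (.inr hb))).trans hs
  | copy p e R =>
    intro b hb
    rcases Multiset.mem_cons.1 hb with rfl | hb
    · exact (hS _ (Multiset.mem_cons_self _ _)).trans hs
    · exact (hS b hb).trans hs
  | delete p e R => exact fun b hb => (hS b (Multiset.mem_cons_of_mem hb)).trans hs

theorem TokRun.size_le {a : ℕ} (ha : ∀ c, Λ.arity c ≤ a) {π : List (Transition Λ)}
    {S S' : Tokens Λ n} (h : TokRun S π S') {s : ℕ} (hS : ∀ b ∈ S, b.2.size ≤ s) :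
    ∀ b ∈ S', b.2.size ≤ (growth a)^[π.length] s := by
  induction h generalizing s with
  | nil S => exact hS
  | cons S₁ S₂ S₃ x π hx _ ih => exact ih (hx.size_le ha hS)

/-- Initial tokens carry variables, of size `0`, and each transition enlarges terms by at most
`growth`. -/
theorem size_le_of_mem_fromPath {a : ℕ} (ha : ∀ c, Λ.arity c ≤ a) {π : List (Transition Λ)}
    {e : Prog Λ t} (he : e ∈ fromPath Λ t 𝒜 π) {l : ℕ} (hl : π.length ≤ l) :
    e.size ≤ (growth a)^[l] 0 := by
  obtain ⟨f, h⟩ := he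
  refine (h.size_le ha (s := 0) (fun b hb => ?_) _ (Multiset.mem_singleton_self _)).trans
    ((growth_mono a).monotone_iterate_of_le_map (Nat.zero_le _) hl)
  obtain ⟨i, _, rfl⟩ := Multiset.mem_map.1 hb
  exact le_rfl

end Size

/-! ### Termination and progress of the loop -/

section Synthesis

variable {K : TyCons} {Λ : Library K} {t : Ty K Empty} {𝒜 𝒜' : Set (AbsTy K)} {m : Measure}

theorem SynAbstract.none_iff (h𝒜 : IsCover 𝒜) :
    SynAbstract m Λ t 𝒜 none ↔ ∀ e : Prog Λ t, ¬ AbsCheck 𝒜 t e := by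
  constructor
  · rintro (h | _) e he
    obtain ⟨π, hπ, _⟩ := he.exists_validPath h𝒜
    exact h π hπ
  · intro h
    refine .fail fun π hπ => ?_
    obtain ⟨e, _, he⟩ := hπ.exists_absCheck h𝒜
    exact h e he

theorem SynAbstract.exists (m : Measure) (Λ : Library K) (t : Ty K Empty) (h𝒜 : IsCover 𝒜) :
    ∃ r, SynAbstract m Λ t 𝒜 r := by
  classical
  by_cases h : ∃ l π, (atn Λ t 𝒜).ValidPath π ∧ pathLength m π = l
  · obtain ⟨π, hπ, hl⟩ := Nat.find_spec h
    obtain ⟨e, he, hA⟩ := hπ.exists_absCheck h𝒜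
    exact ⟨_, .found π e ⟨hπ, fun π' hπ' => hl ▸ Nat.find_min' h ⟨π', hπ', rfl⟩⟩ he hA⟩
  · exact ⟨none, .fail fun π hπ => h ⟨_, π, hπ, rfl⟩⟩

theorem SynAbstract.absCheck {e : Prog Λ t} (h : SynAbstract m Λ t 𝒜 (some e)) :
    AbsCheck 𝒜 t e := by
  cases h with
  | found π e _ _ h => exact h

theorem AbsCheck.progLength_ne_top (h𝒜 : IsCover 𝒜) {e : Prog Λ t} (he : AbsCheck 𝒜 t e) :
    progLength m Λ t 𝒜 e ≠ ⊤ := by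
  obtain ⟨π, h1, h2, _⟩ := he.exists_validPath h𝒜
  exact ((iInf₂_le π ⟨h1, h2⟩).trans_lt (ENat.natCast_lt_top _)).ne

theorem SynAbstract.progLength_le {e : Prog Λ t} (h : SynAbstract m Λ t 𝒜 (some e))
    (e' : Prog Λ t) : progLength m Λ t 𝒜 e ≤ progLength m Λ t 𝒜 e' := by
  cases h with
  | found π e hπ he _ =>
    exact le_iInf₂ fun π' hπ' => (iInf₂_le π ⟨hπ.1, he⟩).trans (Nat.cast_le.2 (hπ.2 π' hπ'.1))

theorem SynAbstract.size_le (h𝒜 : IsCover 𝒜) {e e' : Prog Λ t}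
    (h : SynAbstract .components Λ t 𝒜 (some e)) (he' : AbsCheck 𝒜 t e') : e.size ≤ e'.size := by
  cases h with
  | found π e hπ he _ =>
    obtain ⟨π', hπ', _, _, hw⟩ := he'.exists_validPath h𝒜
    rw [hπ.size_eq h𝒜 he, ← hw]
    exact hπ.2 π' hπ'

/-- A bound, independent of the cover, for the size of the programs that `SynAbstract` returns. -/
theorem ConcreteCheck.exists_bound {e₀ : Prog Λ t} (h₀ : ConcreteCheck t e₀) (m : Measure) :
    ∃ N, (m = .components → N = e₀.size) ∧ ∀ 𝒜, IsCover 𝒜 →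
      ∀ e, SynAbstract m Λ t 𝒜 (some e) → e.size ≤ N := by
  cases m with
  | components => exact ⟨e₀.size, fun _ => rfl, fun 𝒜 h𝒜 e he => he.size_le h𝒜 (h₀.absCheck h𝒜)⟩
  | transitions =>
    have := Λ.finite
    obtain ⟨a, ha⟩ := (Set.finite_range Λ.arity).bddAbove
    -- The iteration count bounds the length of some valid path for the solution in any cover, hence
    -- that of a shortest path.
    refine ⟨(growth a)^[Multiset.card e₀.occs + t.args.length + e₀.size] 0,
      fun h => (nomatch h), fun 𝒜 h𝒜 e he => ?_⟩
    cases he with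
    | found π e hπ he _ =>
      obtain ⟨π', hπ', _, hl, _⟩ := (h₀.absCheck h𝒜).exists_validPath h𝒜
      exact size_le_of_mem_fromPath (fun c => ha ⟨c, rfl⟩) he ((hπ.2 π' hπ').trans hl)

theorem Iteration.exists (m : Measure) (Λ : Library K) (t : Ty K Empty) (h𝒜 : IsCover 𝒜) :
    ∃ r s, Iteration m Λ t (.loop 𝒜) r s := by
  obtain ⟨r, hr⟩ := SynAbstract.exists m Λ t h𝒜
  cases r with
  | none => exact ⟨_, _, .fail 𝒜 hr⟩
  | some e =>
    by_cases he : ConcreteCheck t e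
    · exact ⟨_, _, .success 𝒜 e hr he⟩
    · obtain ⟨𝒜', h⟩ := Refine.exists 𝒜 e
      exact ⟨_, _, .refine 𝒜 𝒜' e hr he h⟩

/-- The invariant of the executions of `Synthesize`, for a query with a solution. -/
theorem Execution.invariant {e₀ : Prog Λ t} (h₀ : ConcreteCheck t e₀) {N : ℕ}
    (hN : ∀ 𝒜, IsCover 𝒜 → ∀ e, SynAbstract m Λ t 𝒜 (some e) → e.size ≤ N)
    {s s' : State Λ t} {rs : List (Option (Prog Λ t))} (h : Execution m Λ t s rs s')
    (h𝒜 : IsCover 𝒜) (hs : s = .loop 𝒜) :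
    (∀ r ∈ rs, ∃ e : Prog Λ t, r = some e ∧ AbsCheck 𝒜 t e ∧ e.size ≤ N) ∧ rs.Nodup ∧
      (∀ 𝒜', s' = .loop 𝒜' → IsCover 𝒜') ∧
      ∀ r, s' = .returned r → ∃ e, r = some e ∧ ConcreteCheck t e := by
  induction h generalizing 𝒜 with
  | nil s =>
    subst hs
    refine ⟨by simp, List.nodup_nil, fun 𝒜' h => ?_, fun r h => nomatch h⟩
    cases h
    exact h𝒜
  | cons s₁ s₂ s₃ r rs hit hex ih =>
    subst hs
    cases hit with
    -- The solution `e₀` passes the check in every cover, so `⊥` is never returned.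
    | fail _ hr => exact ((SynAbstract.none_iff h𝒜).1 hr e₀ (h₀.absCheck h𝒜)).elim
    | success _ e hr he =>
      cases hex with
      | nil =>
        refine ⟨?_, List.nodup_singleton _, fun 𝒜' h => (nomatch h), fun r h => ?_⟩
        · rintro r hr'
          obtain rfl := List.mem_singleton.1 hr'
          exact ⟨e, rfl, hr.absCheck, hN 𝒜 h𝒜 e hr⟩
        · cases h
          exact ⟨e, rfl, he⟩
      | cons _ _ _ _ _ hit _ => nomatch hit
    | refine _ 𝒜' e hr he href =>
      have h𝒜' := href.isCover h𝒜
      obtain ⟨h1, h2, h3⟩ := ih h𝒜' rfl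
      refine ⟨List.forall_mem_cons.2 ⟨⟨e, rfl, hr.absCheck, hN 𝒜 h𝒜 e hr⟩, fun r hr' => ?_⟩,
        List.nodup_cons.2 ⟨fun hmem => ?_, h2⟩, h3⟩
      · obtain ⟨e', rfl, hA, hle⟩ := h1 r hr'
        exact ⟨e', rfl, hA.anti h𝒜 h𝒜' href.subset, hle⟩
      -- All later results are abstractly well-typed already in the refined cover, where `e` is not.
      · obtain ⟨e', he', hA, _⟩ := h1 _ hmem
        obtain rfl := Option.some.inj he'
        exact href.not_absCheck h𝒜 he hA

theorem Execution.length_le {e₀ : Prog Λ t} (h₀ : ConcreteCheck t e₀) {N : ℕ}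
    (hN : ∀ 𝒜, IsCover 𝒜 → ∀ e, SynAbstract m Λ t 𝒜 (some e) → e.size ≤ N)
    {s' : State Λ t} {rs : List (Option (Prog Λ t))} (h : Execution m Λ t (.loop 𝒜) rs s')
    (h𝒜 : IsCover 𝒜) : rs.length ≤ {e : Prog Λ t | e.size ≤ N}.ncard := by
  classical
  obtain ⟨h1, h2, _⟩ := h.invariant h₀ hN h𝒜 rfl
  rw [← List.toFinset_card_of_nodup h2, ← Set.ncard_coe_finset,
    ← Set.ncard_image_of_injective {e : Prog Λ t | e.size ≤ N} (Option.some_injective _)]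
  refine Set.ncard_le_ncard (fun r hr => ?_) ((ATm.finite_size_le Λ _ N).image _)
  obtain ⟨e, rfl, _, he⟩ := h1 r (by simpa using hr)
  exact ⟨e, he, rfl⟩

/-- An execution that has not returned can be prolonged, so it either returns or reaches any
prescribed length; the bound on lengths excludes the latter. -/
theorem exists_returns_or_execution {e₀ : Prog Λ t} (h₀ : ConcreteCheck t e₀) (k : ℕ)
    (h𝒜 : IsCover 𝒜) : (∃ e : Prog Λ t, SynthesizeReturns m Λ t 𝒜 (some e)) ∨
      ∃ rs s, Execution m Λ t (.loop 𝒜) rs s ∧ rs.length = k := by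
  induction k generalizing 𝒜 with
  | zero => exact .inr ⟨[], _, .nil _, rfl⟩
  | succ k ih =>
    obtain ⟨r, s, h⟩ := Iteration.exists m Λ t h𝒜
    cases h with
    | fail _ hr => exact ((SynAbstract.none_iff h𝒜).1 hr e₀ (h₀.absCheck h𝒜)).elim
    | success _ e hr he => exact .inl ⟨e, _, .cons _ _ _ _ _ (.success 𝒜 e hr he) (.nil _)⟩
    | refine _ 𝒜' e hr he href =>
      have hit := Iteration.refine 𝒜 𝒜' e hr he href
      rcases ih (href.isCover h𝒜) with ⟨e', rs, hex⟩ | ⟨rs, s, hex, hl⟩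
      · exact .inl ⟨e', _, .cons _ _ _ _ _ hit hex⟩
      · exact .inr ⟨_, _, .cons _ _ _ _ _ hit hex, by rw [List.length_cons, hl]⟩

theorem exists_synthesizeReturns {e₀ : Prog Λ t} (h₀ : ConcreteCheck t e₀) (m : Measure)
    (h𝒜 : IsCover 𝒜) : ∃ e : Prog Λ t, SynthesizeReturns m Λ t 𝒜 (some e) := by
  obtain ⟨N, _, hN⟩ := h₀.exists_bound m
  rcases exists_returns_or_execution (m := m) h₀ ({e : Prog Λ t | e.size ≤ N}.ncard + 1) h𝒜 with
    h | ⟨rs, s, hex, hl⟩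
  · exact h
  · have := hex.length_le h₀ hN h𝒜
    omega

end Synthesis
end TYGAR

/-! ### Assembly of the three claims -/

open TYGAR in
theorem mainTheorem7 {K : TyCons} (Λ : Library K) (t : Ty K Empty) (m : Measure) :
    -- completeness of `Synthesize`, with a bound on the number of iterations
    (∀ E : NTm Λ, NTyping Λ [] E t →
      ∃ N : ℕ, (m = .components → N = E.size) ∧ {e : Prog Λ t | e.size ≤ N}.Finite ∧
        ∀ 𝒜₀ : Set (AbsTy K), IsCover 𝒜₀ →
          (∃ E' : Prog Λ t, SynthesizeReturns m Λ t 𝒜₀ (some E')) ∧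
          (∀ r, SynthesizeReturns m Λ t 𝒜₀ r → ∃ E', r = some E' ∧ NTyping Λ [] E'.close t) ∧
          ∀ rs s, Execution m Λ t (.loop 𝒜₀) rs s →
            (∀ 𝒜, s = .loop 𝒜 → ∃ r s', Iteration m Λ t s r s') ∧
            rs.Nodup ∧ (∀ r ∈ rs, ∃ e : Prog Λ t, r = some e ∧ e.size ≤ N) ∧
            rs.length ≤ {e : Prog Λ t | e.size ≤ N}.ncard) ∧
    -- `SynAbstract` returns a shortest abstractly well-typed program if there is one
    (∀ 𝒜 : Set (AbsTy K), IsCover 𝒜 →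
      (∀ π, (fromPath Λ t 𝒜 π).Finite) ∧
      (∃ r, SynAbstract m Λ t 𝒜 r) ∧
      (SynAbstract m Λ t 𝒜 none ↔ ∀ e : Prog Λ t, ¬ AbsCheck 𝒜 t e) ∧
      ∀ e, SynAbstract m Λ t 𝒜 (some e) →
        AbsCheck 𝒜 t e ∧
        ∀ e', AbsCheck 𝒜 t e' →
          progLength m Λ t 𝒜 e ≤ progLength m Λ t 𝒜 e' ∧ progLength m Λ t 𝒜 e' ≠ ⊤ ∧
          (m = .components → e.size ≤ e'.size)) ∧
    -- `Refine` terminates and excludes every spurious program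
    (∀ 𝒜 : Set (AbsTy K), IsCover 𝒜 →
      ∀ e : Prog Λ t, AbsCheck 𝒜 t e → ¬ ConcreteCheck t e →
        (∃ 𝒜', Refine t 𝒜 e 𝒜') ∧
        (∀ c R, WellFounded fun Bs' Bs => WeakenStep (Λ.addGoal t.res) c R Bs Bs') ∧
        ∀ 𝒜', Refine t 𝒜 e 𝒜' → IsCover 𝒜' ∧ 𝒜 ⊆ 𝒜' ∧ ¬ AbsCheck 𝒜' t e) := by
  refine ⟨fun E hE => ?_, fun 𝒜 h𝒜 => ⟨finite_fromPath, SynAbstract.exists m Λ t h𝒜,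
    SynAbstract.none_iff h𝒜, fun e he => ⟨he.absCheck, fun e' he' => ⟨he.progLength_le e',
      he'.progLength_ne_top h𝒜, fun hm => ?_⟩⟩⟩, fun 𝒜 h𝒜 e _ he => ⟨Refine.exists 𝒜 e,
      fun c R => WeakenStep.wellFounded _ c R, fun 𝒜' h => ⟨h.isCover h𝒜, h.subset,
        h.not_absCheck h𝒜 he⟩⟩⟩
  · obtain ⟨e₀, h₀, hsize⟩ := hE.exists_concreteCheck
    obtain ⟨N, hNm, hN⟩ := h₀.exists_bound m
    refine ⟨N, fun hm => (hNm hm).trans hsize, ATm.finite_size_le Λ _ N, fun 𝒜₀ h𝒜₀ =>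
      ⟨exists_synthesizeReturns h₀ m h𝒜₀, ?_, fun rs s hex => ?_⟩⟩
    · rintro r ⟨rs, hex⟩
      obtain ⟨e, rfl, he⟩ := (hex.invariant h₀ hN h𝒜₀ rfl).2.2.2 r rfl
      exact ⟨e, rfl, he.nTyping⟩
    · obtain ⟨h1, h2, h3, _⟩ := hex.invariant h₀ hN h𝒜₀ rfl
      refine ⟨?_, h2, fun r hr => ?_, hex.length_le h₀ hN h𝒜₀⟩
      · rintro 𝒜 rfl
        exact Iteration.exists m Λ t (h3 𝒜 rfl)
      · obtain ⟨e, he, _, hle⟩ := h1 r hr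
        exact ⟨e, he, hle⟩
  · subst hm
    exact he.size_le h𝒜 he'
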